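/- Let $G$ be a finitely generated group with decidable word problem and undecidable domino problem; the latter means that no algorithm decides, given a finite alphabet $A$ and a finite set $\mathcal F$ of patterns $p\colon F\to A$ with $F\subset G$ finite (positions being given by words in a fixed finite set of generators and their inverses), whether the subshift of finite type $X_{\mathcal F}=A^G\setminus\bigcup_{g\in G}\bigcup_{p\in\mathcal F} g[p]$ is nonempty. Here $[p]$ is the set of all $x\in A^G$ with $x|_F=p$, and $G$ acts on $A^G$ by $(g\cdot x)(h)=x(g^{-1}h)$. Then there exists a weakly effective dynamical system $G\curvearrowright X$ that is not a topological factor of any effective dynamical system $G\curvearrowright U$. Moreover $X$ is topologically conjugate to the inverse limit of a sequence of effective subshifts on $G$ along topological factor maps. The notions are the following. A topological factor map is a continuous $G$-equivariant surjection, and a topological conjugacy is a $G$-equivariant homeomorphism. An action $G\curvearrowright U$ is an effective dynamical system (EDS) if it is topologically conjugate to an action of $G$ by computable maps on a recursively compact subset of a computable metric space. It is a zero-dimensional EDS if it is topologically conjugate to an action of $G$ by computable maps on an effectively closed subset of $\{0,1\}^{\mathbb N}$, that is, on the complement of a recursively enumerable union of cylinders. A subshift, that is, a closed $G$-invariant subset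 of $A^G$ with $A$ finite, is effective if its shift action is a zero-dimensional EDS. A weakly effective dynamical system is an action that is topologically conjugate to the inverse limit of a sequence of zero-dimensional EDS along topological factor maps. -/

import Mathlib

universe u v

namespace EffDyn

open SymbolicDynamics.FullShift

/-! ### Factor maps and inverse limits -/

/-- A topological factor map: continuous, `G`-equivariant and surjective. -/
structure IsFactorMap (G : Type*) [Group G] {X Y : Type*}
    [TopologicalSpace X] [MulAction G X] [TopologicalSpace Y] [MulAction G Y]
    (f : X → Y) : Prop where
  continuous : Continuous f
  map_smul : ∀ (g : G) (x : X), f (g • x) = g • f x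
  surjective : Function.Surjective f

/-- The action of `G` on `Y` is a topological factor of the action of `G` on `X`. -/
def IsTopologicalFactor (G : Type*) [Group G] (Y X : Type*)
    [TopologicalSpace Y] [MulAction G Y] [TopologicalSpace X] [MulAction G X] : Prop :=
  ∃ f : X → Y, IsFactorMap G f

/-- The inverse limit of a sequence of maps `π n : Y (n + 1) → Y n`, a subspace of the product. -/
def InverseLimit (Y : ℕ → Type*) (π : ∀ n, Y (n + 1) → Y n) : Set (∀ n, Y n) :=
  {y | ∀ n, y n = π n (y (n + 1))}

/-- The action of `G` on `X` is topologically conjugate to the inverse limit, with the pointwise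
action, of the actions of `G` on the spaces `Y n` along some sequence of topological factor maps
`Y (n + 1) → Y n`. -/
def IsInverseLimitOf (G : Type*) [Group G] (X : Type*) [TopologicalSpace X] [MulAction G X]
    (Y : ℕ → Type*) [∀ n, TopologicalSpace (Y n)] [∀ n, MulAction G (Y n)] : Prop :=
  ∃ π : ∀ n, Y (n + 1) → Y n, (∀ n, IsFactorMap G (π n)) ∧
    ∃ e : X ≃ₜ InverseLimit Y π, ∀ (g : G) (x : X) (n : ℕ),
      (e (g • x)).1 n = g • (e x).1 n

/-! ### Computability in the Cantor space -/

/-- The word formed by the first `n` symbols of `x`. -/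
def initialWord (x : ℕ → Bool) (n : ℕ) : List Bool := (List.range n).map x

/-- The cylinder of all points of the Cantor space that begin with the word `w`. -/
def cyl (w : List Bool) : Set (ℕ → Bool) := {x | initialWord x w.length = w}

/-- The complement of a recursively enumerable union of cylinders. -/
def IsEffectivelyClosed (Y : Set (ℕ → Bool)) : Prop :=
  ∃ L : List Bool → Prop, REPred L ∧ Y = (⋃ w ∈ {w | L w}, cyl w)ᶜ

/-- A map defined on a subset `Y` of the Cantor space is computable: a partial computable map of
words sends the initial words of each `x ∈ Y` to words with nested cylinders that shrink to
the single point `f x`. -/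
def IsComputableCantorMap {Y : Set (ℕ → Bool)} (f : Y → (ℕ → Bool)) : Prop :=
  ∃ φ : List Bool →. List Bool, Partrec φ ∧ ∀ x : Y, ∃ u : ℕ → List Bool,
    (∀ n, u n ∈ φ (initialWord x.1 (n + 1))) ∧
    (∀ n, cyl (u (n + 1)) ⊆ cyl (u n)) ∧
    ⋂ n, cyl (u n) = {f x}

/-- Zero-dimensional effective dynamical systems: up to a topological conjugacy `e`, the group
acts by computable maps on an effectively closed subset of the Cantor space. -/
def IsZeroDimEDS (G : Type*) [Group G] (X : Type*) [TopologicalSpace X] [MulAction G X] : Prop :=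
  ∃ Y : Set (ℕ → Bool), IsEffectivelyClosed Y ∧ ∃ e : X ≃ₜ Y,
    ∀ g : G, IsComputableCantorMap (fun y : Y => (e (g • e.symm y)).1)

/-! ### Computability in metric spaces -/

/-- `s` is a dense sequence that makes `M` a computable metric space: the distances between
its terms are computable real numbers, uniformly in the indices. -/
def IsComputableMetricSpace (M : Type*) [MetricSpace M] (s : ℕ → M) : Prop :=
  DenseRange s ∧ ∃ d : ℕ × ℕ × ℕ → ℕ, Computable d ∧
    ∀ i j k : ℕ, |dist (s i) (s j) - (d (i, j, k) : ℝ) / 2 ^ k| ≤ 1 / 2 ^ k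

/-- The basic ball with code `(i, p, q)`: centre `s i` and rational radius `p / (q + 1)`. -/
def basicBall {M : Type*} [MetricSpace M] (s : ℕ → M) (b : ℕ × ℕ × ℕ) : Set M :=
  Metric.ball (s b.1) ((b.2.1 : ℝ) / ((b.2.2 : ℝ) + 1))

/-- `Y` is compact and one can semi-decide whether finitely many basic balls cover it. -/
def IsRecursivelyCompact {M : Type*} [MetricSpace M] (s : ℕ → M) (Y : Set M) : Prop :=
  IsCompact Y ∧ REPred (fun l : List (ℕ × ℕ × ℕ) => Y ⊆ ⋃ b ∈ l, basicBall s b)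

/-- `f : Y → Y` is computable: preimages of basic balls are, uniformly in the ball, unions
(relative to `Y`) of recursively enumerable families of basic balls. -/
def IsComputableMap {M : Type*} [MetricSpace M] (s : ℕ → M) {Y : Set M} (f : Y → Y) : Prop :=
  ∃ R : (ℕ × ℕ × ℕ) × (ℕ × ℕ × ℕ) → Prop, REPred R ∧
    ∀ (b : ℕ × ℕ × ℕ) (y : Y),
      (f y : M) ∈ basicBall s b ↔ ∃ a, R (a, b) ∧ (y : M) ∈ basicBall s a

/-- Effective dynamical systems, of any dimension: up to a topological conjugacy `e`, the group
acts by computable maps on a recursively compact subset of a computable metric space. -/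
def IsEDS (G : Type u) [Group G] (X : Type v) [TopologicalSpace X] [MulAction G X] : Prop :=
  ∃ (M : Type v) (_ : MetricSpace M) (s : ℕ → M), IsComputableMetricSpace M s ∧
    ∃ Y : Set M, IsRecursivelyCompact s Y ∧ ∃ e : X ≃ₜ Y,
      ∀ g : G, IsComputableMap s (fun y : Y => e (g • e.symm y))

/-! ### Effective subshifts and weakly effective dynamical systems -/

/-- The left shift action `(g • x) h = x (g⁻¹ * h)` of `G` on a subshift. -/
instance subshiftAction {A G : Type*} [TopologicalSpace A] [Group G] (X : MulSubshift A G) :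
    MulAction G X.carrier where
  smul g x := ⟨fun h => x.1 (g⁻¹ * h), X.mapsTo g⁻¹ x.2⟩
  one_smul x := Subtype.ext (funext fun h => congrArg x.1 (by simp))
  mul_smul g g' x := Subtype.ext (funext fun h => congrArg x.1 (by simp [mul_assoc]))

/-- A subshift is effective if its shift action is a zero-dimensional effective dynamical
system. -/
def IsEffectiveSubshift {A G : Type*} [TopologicalSpace A] [Group G] (X : MulSubshift A G) :
    Prop :=
  IsZeroDimEDS G X.carrier

/-- Weakly effective dynamical systems: inverse limits of sequences of zero-dimensional effective
dynamical systems. -/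
def IsWEDS (G : Type*) [Group G] (X : Type u) [TopologicalSpace X] [MulAction G X] : Prop :=
  ∃ (Y : ℕ → Type u) (_ : ∀ n, TopologicalSpace (Y n)) (_ : ∀ n, MulAction G (Y n)),
    (∀ n, IsZeroDimEDS G (Y n)) ∧ IsInverseLimitOf G X Y

/-- The action is topologically conjugate to an inverse limit of a sequence of effective
subshifts over finite alphabets. -/
def IsInverseLimitOfEffectiveSubshifts (G : Type*) [Group G] (X : Type*)
    [TopologicalSpace X] [MulAction G X] : Prop :=
  ∃ (k : ℕ → ℕ) (Y : ∀ n, MulSubshift (Fin (k n)) G),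
    (∀ n, IsEffectiveSubshift (Y n)) ∧ IsInverseLimitOf G X (fun n => (Y n).carrier)

/-! ### The word problem and the domino problem -/

/-- The group element represented by a word in the generators `s i` and their inverses; the
letter `(i, true)` stands for `s i` and `(i, false)` for its inverse. -/
def wordValue {G : Type*} [Group G] {n : ℕ} (s : Fin n → G) (w : List (Fin n × Bool)) : G :=
  (w.map fun l => cond l.2 (s l.1) (s l.1)⁻¹).prod

/-- The word problem of `G` with respect to the generators `s` is decidable. -/
def DecidableWordProblem {G : Type*} [Group G] {n : ℕ} (s : Fin n → G) : Prop :=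
  ComputablePred (fun w : List (Fin n × Bool) => wordValue s w = 1)

/-- The code of a pattern: a finite list of pairs (word representing a position, symbol there). -/
abbrev PatternCode (n : ℕ) : Type := List (List (Fin n × Bool) × ℕ)

/-- The pattern with code `p` occurs in `x` at `g`, that is, `x` lies in the translate by `g` of
the cylinder of the pattern. -/
def PatternCode.OccursAt {G : Type*} [Group G] {n k : ℕ} (s : Fin n → G) (p : PatternCode n)
    (x : G → Fin k) (g : G) : Prop :=
  ∀ q ∈ p, (x (g * wordValue s q.1) : ℕ) = q.2

/-- The subshift of finite type over the alphabet `{0, …, k - 1}` with forbidden patterns `F`. -/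
def sft {G : Type*} [Group G] {n : ℕ} (s : Fin n → G) (k : ℕ) (F : List (PatternCode n)) :
    Set (G → Fin k) :=
  {x | ∀ p ∈ F, ∀ g : G, ¬ p.OccursAt s x g}

/-- The domino problem of `G` with respect to the generators `s` is decidable: an algorithm
decides, given an alphabet size and a finite list of forbidden patterns, whether the subshift of
finite type that they define is nonempty. -/
def DecidableDominoProblem {G : Type*} [Group G] {n : ℕ} (s : Fin n → G) : Prop :=
  ComputablePred (fun i : ℕ × List (PatternCode n) => (sft s i.1 i.2).Nonempty)

end EffDyn

/-! The idea is to build a system that maps equivariantly into every nonempty subshift of finite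
type, and to show that an effective system with this property would solve the domino problem.

Let `T` enumerate all nonempty subshifts of finite type (`exists_enumeration_nonempty_sft`). The
enumeration is not assumed computable. The product of the first `N` of them is still an effective
subshift, because finitely many alphabets and pattern lists can be hard-coded and the word problem
is decidable (`isEffectiveSubshift_layeredSubshift`). Forgetting the last layer is a factor map,
since each layer is nonempty. The system `X` is the inverse limit of these products, and projecting
to a layer gives a map from `X` into each nonempty subshift of finite type.

Suppose an effective system `U` factors onto `X`. Then `U` also maps equivariantly into every
nonempty subshift of finite type. For a fixed nonempty `U`, such a map has a finite certificate: a
cover of `U` by balls carrying symbols, where differently labelled balls are apart and each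
forbidden pattern is locally avoided. Recursive compactness and computability of the generators make
certificates semidecidable. Conversely, reading the labels along one orbit of `U` turns any
certificate into a point of the subshift (`exists_rePred_of_isEDS`). Hence nonemptiness is
recursively enumerable.

Emptiness is recursively enumerable as well, by compactness and the word problem
(`rePred_not_nonempty_sft`). The domino problem would therefore be decidable. -/

open SymbolicDynamics.FullShift

namespace EffDyn

/-! ### Closure properties of recursively enumerable predicates. -/

section RecursivelyEnumerable

variable {α β γ : Type*} [Primcodable α] [Primcodable β] [Primcodable γ]

/-- A recursively enumerable predicate is the union of an increasing primitive recursive sequence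
of decidable predicates. -/
lemma exists_primrecRel_of_rePred {p : α → Prop} (hp : REPred p) :
    ∃ q : α → ℕ → Prop, PrimrecRel q ∧ (∀ a m n, m ≤ n → q a m → q a n) ∧
      ∀ a, p a ↔ ∃ n, q a n := by
  obtain ⟨c, hc⟩ := Nat.Partrec.Code.exists_code.1 hp
  refine ⟨fun a k => (Nat.Partrec.Code.evaln k c (Encodable.encode a)).isSome = true, ?_, ?_, ?_⟩
  · refine Primrec.eq.comp (Primrec.option_isSome.comp (Nat.Partrec.Code.primrec_evaln.comp
      ((Primrec.snd.pair (Primrec.const c)).pair (Primrec.encode.comp Primrec.fst))))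
      (Primrec.const true)
  · intro a m n hmn h
    obtain ⟨x, hx⟩ := Option.isSome_iff_exists.1 h
    exact Option.isSome_iff_exists.2 ⟨x, Nat.Partrec.Code.evaln_mono hmn hx⟩
  · intro a
    have h1 : p a ↔ (c.eval (Encodable.encode a)).Dom := by
      rw [hc]; simp [Part.assert]
    rw [h1, Part.dom_iff_mem]
    simp only [Nat.Partrec.Code.evaln_complete, Option.isSome_iff_exists]
    exact exists_comm

lemma rePred_of_primrecRel {p : α → Prop} {q : α → ℕ → Prop} (hq : PrimrecRel q)
    (h : ∀ a, p a ↔ ∃ n, q a n) : REPred p := by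
  classical
  have hq' : Computable₂ fun a n => decide (q a n) := by
    obtain ⟨_, hq⟩ := hq
    exact (hq.to_comp).of_eq fun _ => by simp
  have := (Partrec.rfind (p := fun a n => Part.some (decide (q a n))) hq'.partrec₂).dom_re
  refine this.of_eq fun a => ?_
  rw [h]
  refine (Nat.rfind_dom (p := fun n => Part.some (decide (q a n)))).trans ?_
  simp

lemma rePred_of_primrecPred {p : α → Prop} (hp : PrimrecPred p) : REPred p := by
  obtain ⟨_, hp⟩ := hp
  exact ComputablePred.to_re ⟨inferInstance, hp.to_comp⟩

lemma _root_.REPred.comp {p : β → Prop} (hp : REPred p) {f : α → β} (hf : Computable f) :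
    REPred fun a => p (f a) :=
  Partrec.comp hp hf

lemma _root_.REPred.and {p q : α → Prop} (hp : REPred p) (hq : REPred q) :
    REPred fun a => p a ∧ q a := by
  obtain ⟨p', hp', mp, ep⟩ := exists_primrecRel_of_rePred hp
  obtain ⟨q', hq', mq, eq⟩ := exists_primrecRel_of_rePred hq
  refine rePred_of_primrecRel (q := fun a n => p' a n ∧ q' a n) (PrimrecPred.and hp' hq') ?_
  intro a
  rw [ep, eq]
  constructor
  · rintro ⟨⟨m, hm⟩, n, hn⟩
    exact ⟨max m n, mp _ _ _ (le_max_left _ _) hm, mq _ _ _ (le_max_right _ _) hn⟩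
  · rintro ⟨n, h1, h2⟩
    exact ⟨⟨n, h1⟩, n, h2⟩

lemma _root_.REPred.or {p q : α → Prop} (hp : REPred p) (hq : REPred q) :
    REPred fun a => p a ∨ q a := by
  obtain ⟨p', hp', mp, ep⟩ := exists_primrecRel_of_rePred hp
  obtain ⟨q', hq', mq, eq⟩ := exists_primrecRel_of_rePred hq
  refine rePred_of_primrecRel (q := fun a n => p' a n ∨ q' a n) (PrimrecPred.or hp' hq') ?_
  intro a
  rw [ep, eq, exists_or]

/-- Dovetailing: one natural number codes both a candidate witness and the stage at which it is
verified. -/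
lemma _root_.REPred.exists {p : α → β → Prop} (hp : REPred fun x : α × β => p x.1 x.2) :
    REPred fun a => ∃ b, p a b := by
  obtain ⟨q, ⟨d, hq⟩, -, e⟩ := exists_primrecRel_of_rePred hp
  let f : α → ℕ → Bool := fun a n =>
    Option.casesOn (Encodable.decode (α := β) n.unpair.1) false
      fun b => @decide (q (a, b) n.unpair.2) (d ((a, b), n.unpair.2))
  have hf : Primrec₂ f := by
    refine Primrec.option_casesOn (Primrec.decode.comp (Primrec.fst.comp
      (Primrec.unpair.comp Primrec.snd))) (Primrec.const false) ?_
    exact hq.comp (((Primrec.fst.comp Primrec.fst).pair Primrec.snd).pair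
        (Primrec.snd.comp (Primrec.unpair.comp (Primrec.snd.comp Primrec.fst))))
  refine rePred_of_primrecRel (q := fun a n => f a n = true)
    (Primrec.eq.comp hf (Primrec.const true)) fun a => ?_
  constructor
  · rintro ⟨b, hb⟩
    obtain ⟨n, hn⟩ := (e (a, b)).1 hb
    exact ⟨Nat.pair (Encodable.encode b) n, by simpa [f] using hn⟩
  · rintro ⟨n, hn⟩
    cases hd : Encodable.decode (α := β) n.unpair.1 with
    | none => simp [f, hd] at hn
    | some b => exact ⟨b, (e (a, b)).2 ⟨n.unpair.2, by simpa [f, hd] using hn⟩⟩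

/-- Stages are monotone, so the finitely many entries are all verified at the maximum of their
stages. -/
lemma _root_.REPred.forall_mem_list {p : α → β → Prop} (hp : REPred fun x : α × β => p x.1 x.2) :
    REPred fun x : List α × β => ∀ a ∈ x.1, p a x.2 := by
  obtain ⟨q, hq, mq, e⟩ := exists_primrecRel_of_rePred hp
  have h : PrimrecRel fun (a : α) (y : β × ℕ) => q (a, y.1) y.2 :=
    PrimrecRel.comp hq (Primrec.fst.pair (Primrec.fst.comp Primrec.snd))
      (Primrec.snd.comp Primrec.snd)
  refine rePred_of_primrecRel (q := fun x n => ∀ a ∈ x.1, q (a, x.2) n)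
    (PrimrecRel.comp h.forall_mem_list (Primrec.fst.comp Primrec.fst)
      ((Primrec.snd.comp Primrec.fst).pair Primrec.snd)) ?_
  rintro ⟨l, b⟩
  simp only [e (_, b)]
  constructor
  · intro h
    induction l with
    | nil => exact ⟨0, by simp⟩
    | cons a l ih =>
      obtain ⟨m, hm⟩ := h a (by simp)
      obtain ⟨n, hn⟩ := ih fun a ha => h a (by simp [ha])
      refine ⟨max m n, fun c hc => ?_⟩
      rcases List.mem_cons.1 hc with rfl | hc
      · exact mq _ _ _ (le_max_left _ _) hm
      · exact mq _ _ _ (le_max_right _ _) (hn c hc)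
  · rintro ⟨n, hn⟩ a ha
    exact ⟨n, hn a ha⟩

lemma primrecRel_mem_list : PrimrecRel fun (a : α) (l : List α) => a ∈ l := by
  have h := (PrimrecRel.exists_mem_list (R := fun (b a : α) => b = a) Primrec.eq).comp
    (f := fun x : α × List α => x.2) (g := fun x => x.1) Primrec.snd Primrec.fst
  exact h.of_eq fun x => by simp

lemma _root_.REPred.exists_mem_list {p : α → β → Prop} (hp : REPred fun x : α × β => p x.1 x.2) :
    REPred fun x : List α × β => ∃ a ∈ x.1, p a x.2 := by
  have h1 : REPred fun y : (List α × β) × α => y.2 ∈ y.1.1 :=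
    rePred_of_primrecPred (primrecRel_mem_list.comp Primrec.snd (Primrec.fst.comp Primrec.fst))
  have h2 : REPred fun y : (List α × β) × α => p y.2 y.1.2 :=
    REPred.comp hp (Computable.snd.pair (Computable.snd.comp Computable.fst))
  exact REPred.exists (p := fun (x : List α × β) a => a ∈ x.1 ∧ p a x.2) (REPred.and h1 h2)

end RecursivelyEnumerable

/-! ### Words in the generators. -/

section Words

variable {G : Type*} [Group G] {n : ℕ} (s : Fin n → G)

@[simp] lemma wordValue_nil : wordValue s [] = 1 := rfl

@[simp] lemma wordValue_cons (l : Fin n × Bool) (w : List (Fin n × Bool)) :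
    wordValue s (l :: w) = cond l.2 (s l.1) (s l.1)⁻¹ * wordValue s w := by
  simp [wordValue]

@[simp] lemma wordValue_append (u w : List (Fin n × Bool)) :
    wordValue s (u ++ w) = wordValue s u * wordValue s w := by
  simp [wordValue]

/-- The formal inverse of a word. -/
def wordInv (w : List (Fin n × Bool)) : List (Fin n × Bool) :=
  (w.map fun l => (l.1, !l.2)).reverse

@[simp] lemma wordValue_wordInv (w : List (Fin n × Bool)) :
    wordValue s (wordInv w) = (wordValue s w)⁻¹ := by
  induction w with
  | nil => simp [wordInv]
  | cons l w ih =>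
    have h : wordInv (l :: w) = wordInv w ++ [(l.1, !l.2)] := by simp [wordInv]
    rw [h, wordValue_append, ih, wordValue_cons s l w, mul_inv_rev]
    rcases l with ⟨i, _ | _⟩ <;> simp

lemma wordValue_surjective (hs : Subgroup.closure (Set.range s) = ⊤) :
    Function.Surjective (wordValue s) := by
  intro g
  have hg : g ∈ Subgroup.closure (Set.range s) := hs ▸ Subgroup.mem_top g
  induction hg using Subgroup.closure_induction with
  | mem x hx =>
    obtain ⟨i, rfl⟩ := hx
    exact ⟨[(i, true)], by simp⟩
  | one => exact ⟨[], rfl⟩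
  | mul x y _ _ hx hy =>
    obtain ⟨u, rfl⟩ := hx
    obtain ⟨w, rfl⟩ := hy
    exact ⟨u ++ w, wordValue_append s u w⟩
  | inv x _ hx =>
    obtain ⟨u, rfl⟩ := hx
    exact ⟨wordInv u, wordValue_wordInv s u⟩

lemma primrec_wordInv : Primrec (wordInv (n := n)) :=
  Primrec.list_reverse.comp (Primrec.list_map Primrec.id
    ((Primrec.fst.comp Primrec.snd).pair (Primrec.not.comp (Primrec.snd.comp Primrec.snd))))

variable {s}

lemma rePred_wordValue_eq (hwp : DecidableWordProblem s) :
    REPred fun x : List (Fin n × Bool) × List (Fin n × Bool) =>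
      wordValue s x.1 = wordValue s x.2 := by
  have h := REPred.comp hwp.to_re (f := fun x : List (Fin n × Bool) × List (Fin n × Bool) =>
    wordInv x.1 ++ x.2) (Primrec.to_comp (Primrec.list_append.comp
      (primrec_wordInv.comp Primrec.fst) Primrec.snd))
  exact h.of_eq fun x => by simp [inv_mul_eq_one]

end Words

/-! ### Semidecidability of emptiness of a subshift of finite type. -/

section Emptiness

/-- All the ways to attach to the entries of a list numbers smaller than `k`. -/
def colorings {α : Type*} (k : ℕ) (V : List α) : List (List (α × ℕ)) :=
  V.foldr (fun v L => L.flatMap fun σ => (List.range k).map fun a => (v, a) :: σ) [[]]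

lemma mem_colorings {α : Type*} {k : ℕ} {V : List α} {σ : List (α × ℕ)} :
    σ ∈ colorings k V ↔ σ.map Prod.fst = V ∧ ∀ e ∈ σ, e.2 < k := by
  induction V generalizing σ with
  | nil => simp +contextual [colorings]
  | cons v V ih =>
    have h : colorings k (v :: V) =
      (colorings k V).flatMap fun σ => (List.range k).map fun a => (v, a) :: σ := rfl
    simp only [h, List.mem_flatMap, List.mem_map, List.mem_range, ih]
    constructor
    · rintro ⟨τ, ⟨rfl, hτ⟩, a, ha, rfl⟩
      simpa using ⟨ha, fun b c => hτ (b, c)⟩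
    · rintro ⟨h1, h2⟩
      rcases σ with _ | ⟨⟨w, a⟩, τ⟩
      · simp at h1
      · simp only [List.map_cons, List.cons.injEq] at h1
        obtain ⟨rfl, rfl⟩ := h1
        exact ⟨τ, ⟨rfl, fun e he => h2 e (by simp [he])⟩, a, h2 (w, a) (by simp), rfl⟩

lemma primrec_colorings {α : Type*} [Primcodable α] :
    Primrec fun x : ℕ × List α => colorings x.1 x.2 := by
  have hcons : Primrec fun z : (((ℕ × List α) × (α × List (List (α × ℕ)))) × List (α × ℕ)) × ℕ =>
      (z.1.1.2.1, z.2) :: z.1.2 :=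
    Primrec.list_cons.comp ((Primrec.fst.comp (Primrec.snd.comp
      (Primrec.fst.comp Primrec.fst))).pair Primrec.snd) (Primrec.snd.comp Primrec.fst)
  have hmap : Primrec fun z : ((ℕ × List α) × (α × List (List (α × ℕ)))) × List (α × ℕ) =>
      (List.range z.1.1.1).map fun a => (z.1.2.1, a) :: z.2 :=
    Primrec.list_map (Primrec.list_range.comp (Primrec.fst.comp (Primrec.fst.comp Primrec.fst)))
      hcons
  have hbind : Primrec fun z : (ℕ × List α) × (α × List (List (α × ℕ))) =>
      z.2.2.flatMap fun σ => (List.range z.1.1).map fun a => (z.2.1, a) :: σ :=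
    Primrec.list_flatMap (g := fun (z : (ℕ × List α) × (α × List (List (α × ℕ)))) σ =>
      (List.range z.1.1).map fun a => (z.2.1, a) :: σ) (Primrec.snd.comp Primrec.snd) hmap
  exact Primrec.list_foldr (h := fun (x : ℕ × List α) (y : α × List (List (α × ℕ))) =>
    y.2.flatMap fun σ => (List.range x.1).map fun a => (y.1, a) :: σ)
    Primrec.snd (Primrec.const [[]]) hbind

variable {G : Type*} [Group G] {n : ℕ} {s : Fin n → G}

lemma isOpen_occursAt (k : ℕ) (p : PatternCode n) (g : G) :
    IsOpen {x : G → Fin k | p.OccursAt s x g} := by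
  have : {x : G → Fin k | p.OccursAt s x g} =
      ⋂ q ∈ {q | q ∈ p}, (fun x : G → Fin k => x (g * wordValue s q.1)) ⁻¹' {a | (a : ℕ) = q.2} := by
    ext x; simp [PatternCode.OccursAt]
  rw [this]
  exact (List.finite_toSet p).isOpen_biInter fun q _ =>
    (isOpen_discrete _).preimage (continuous_apply _)

/-- By compactness, the emptiness of a subshift of finite type is witnessed by finitely many
positions. -/
lemma not_nonempty_sft_iff (hs : Subgroup.closure (Set.range s) = ⊤) (k : ℕ)
    (F : List (PatternCode n)) :
    ¬ (sft s k F).Nonempty ↔ ∃ V : List (List (Fin n × Bool)), ∀ σ ∈ colorings k V,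
      (∃ e ∈ σ, ∃ e' ∈ σ, wordValue s e.1 = wordValue s e'.1 ∧ e.2 ≠ e'.2) ∨
      ∃ p ∈ F, ∃ u, ∀ q ∈ p, ∃ e ∈ σ, wordValue s e.1 = wordValue s (u ++ q.1) ∧ e.2 = q.2 := by
  classical
  constructor
  · intro hempty
    -- Over the empty alphabet a single position has no colouring, so the condition on `V` holds
    -- vacuously.
    rcases k.eq_zero_or_pos with rfl | hk
    · exact ⟨[[]], fun σ hσ => by simp [colorings] at hσ⟩
    have := Fin.pos_iff_nonempty.1 hk
    let U : PatternCode n × List (Fin n × Bool) → Set (G → Fin k) :=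
      fun i => {x | i.1 ∈ F ∧ i.1.OccursAt s x (wordValue s i.2)}
    have hU : ∀ i, IsOpen (U i) := fun i =>
      (isOpen_const (p := i.1 ∈ F)).inter (isOpen_occursAt k i.1 _)
    have hcover : Set.univ ⊆ ⋃ i, U i := by
      intro x _
      have hx : x ∉ sft s k F := fun hx => hempty ⟨x, hx⟩
      simp only [sft, Set.mem_ofPred_eq, not_forall, not_not] at hx
      obtain ⟨p, hp, g, hg⟩ := hx
      obtain ⟨u, rfl⟩ := wordValue_surjective s hs g
      exact Set.mem_iUnion.2 ⟨(p, u), hp, hg⟩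
    obtain ⟨t, ht⟩ := isCompact_univ.elim_finite_subcover U hU hcover
    -- `V` collects the supports of the translated patterns in the finite subcover.
    refine ⟨t.toList.flatMap fun i => i.1.map fun q => i.2 ++ q.1, fun σ hσ => ?_⟩
    rw [mem_colorings] at hσ
    refine or_iff_not_imp_left.2 fun hA => ?_
    -- Extend `σ` to all of `G`. Since no two entries of `σ` conflict, the entry chosen at each
    -- position is immaterial; off `V` the symbol is arbitrary.
    let x : G → Fin k := fun g =>
      if h : ∃ e ∈ σ, wordValue s e.1 = g then ⟨h.choose.2, hσ.2 _ h.choose_spec.1⟩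
      else Classical.arbitrary _
    have hx : ∀ e ∈ σ, (x (wordValue s e.1) : ℕ) = e.2 := by
      intro e he
      have h : ∃ e' ∈ σ, wordValue s e'.1 = wordValue s e.1 := ⟨e, he, rfl⟩
      have hxe : (x (wordValue s e.1) : ℕ) = h.choose.2 := by simp only [x, dif_pos h]
      rw [hxe]
      by_contra hne
      exact hA ⟨_, h.choose_spec.1, e, he, h.choose_spec.2, hne⟩
    obtain ⟨⟨p, u⟩, hi, hp, hocc⟩ := Set.mem_iUnion₂.1 (ht (Set.mem_univ x))
    refine ⟨p, hp, u, fun q hq => ?_⟩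
    have hmem : u ++ q.1 ∈ σ.map Prod.fst := by
      rw [hσ.1, List.mem_flatMap]
      exact ⟨(p, u), by simpa using hi, List.mem_map.2 ⟨q, hq, rfl⟩⟩
    obtain ⟨e, he, hqe⟩ := List.mem_map.1 hmem
    refine ⟨e, he, by rw [hqe], ?_⟩
    rw [← hx e he, hqe, wordValue_append]
    exact hocc q hq
  · rintro ⟨V, hV⟩ ⟨x, hx⟩
    -- Conversely, the restriction to `V` of a point of the subshift is a colouring that refutes
    -- both alternatives.
    have hmem : V.map (fun v => (v, (x (wordValue s v) : ℕ))) ∈ colorings k V := by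
      rw [mem_colorings]
      simp [Function.comp_def]
    rcases hV _ hmem with ⟨e, he, e', he', h1, h2⟩ | ⟨p, hp, u, h⟩
    · obtain ⟨v, -, rfl⟩ := List.mem_map.1 he
      obtain ⟨v', -, rfl⟩ := List.mem_map.1 he'
      exact h2 (by simp only at h1; simp [h1])
    · refine hx p hp (wordValue s u) fun q hq => ?_
      obtain ⟨e, he, h1, h2⟩ := h q hq
      obtain ⟨v, -, rfl⟩ := List.mem_map.1 he
      rw [← wordValue_append, ← h1, ← h2]

lemma rePred_not_nonempty_sft (hs : Subgroup.closure (Set.range s) = ⊤)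
    (hwp : DecidableWordProblem s) :
    REPred fun i : ℕ × List (PatternCode n) => ¬ (sft s i.1 i.2).Nonempty := by
  have hw := rePred_wordValue_eq hwp
  let W := List (Fin n × Bool)
  have hne : REPred fun x : ℕ × ℕ => x.1 ≠ x.2 :=
    rePred_of_primrecPred Primrec.eq.not
  have heq : REPred fun x : ℕ × ℕ => x.1 = x.2 := rePred_of_primrecPred Primrec.eq
  have hA : REPred fun σ : List (W × ℕ) =>
      ∃ e ∈ σ, ∃ e' ∈ σ, wordValue s e.1 = wordValue s e'.1 ∧ e.2 ≠ e'.2 := by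
    have h1 : REPred fun y : (W × ℕ) × (W × ℕ) =>
        wordValue s y.2.1 = wordValue s y.1.1 ∧ y.2.2 ≠ y.1.2 :=
      (REPred.comp hw (f := fun y : (W × ℕ) × (W × ℕ) => (y.2.1, y.1.1))
        (Primrec.to_comp ((Primrec.fst.comp Primrec.snd).pair
          (Primrec.fst.comp Primrec.fst)))).and
      (REPred.comp hne (f := fun y : (W × ℕ) × (W × ℕ) => (y.2.2, y.1.2))
        (Primrec.to_comp ((Primrec.snd.comp Primrec.snd).pair
          (Primrec.snd.comp Primrec.fst))))
    have h2 := REPred.exists_mem_list (p := fun e' e : W × ℕ =>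
      wordValue s e.1 = wordValue s e'.1 ∧ e.2 ≠ e'.2) h1
    have h3 := REPred.comp h2 (f := fun y : (W × ℕ) × List (W × ℕ) => (y.2, y.1))
      (Computable.snd.pair Computable.fst)
    have h4 := REPred.exists_mem_list (p := fun (e : W × ℕ) (σ : List (W × ℕ)) =>
      ∃ e' ∈ σ, wordValue s e.1 = wordValue s e'.1 ∧ e.2 ≠ e'.2) h3
    exact REPred.comp h4 (f := fun σ : List (W × ℕ) => (σ, σ)) (Computable.id.pair Computable.id)
  have hB : REPred fun y : List (PatternCode n) × List (W × ℕ) => ∃ p ∈ y.1, ∃ u : W,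
      ∀ q ∈ p, ∃ e ∈ y.2, wordValue s e.1 = wordValue s (u ++ q.1) ∧ e.2 = q.2 := by
    have h1 : REPred fun y : (W × ℕ) × (W × (W × ℕ)) =>
        wordValue s y.1.1 = wordValue s (y.2.1 ++ y.2.2.1) ∧ y.1.2 = y.2.2.2 :=
      (REPred.comp hw (f := fun y : (W × ℕ) × (W × (W × ℕ)) => (y.1.1, y.2.1 ++ y.2.2.1))
        (Primrec.to_comp ((Primrec.fst.comp Primrec.fst).pair
          (Primrec.list_append.comp (Primrec.fst.comp Primrec.snd)
            (Primrec.fst.comp (Primrec.snd.comp Primrec.snd)))))).and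
      (REPred.comp heq (f := fun y : (W × ℕ) × (W × (W × ℕ)) => (y.1.2, y.2.2.2))
        (Primrec.to_comp ((Primrec.snd.comp Primrec.fst).pair
          (Primrec.snd.comp (Primrec.snd.comp Primrec.snd)))))
    have h2 := REPred.exists_mem_list (p := fun (e : W × ℕ) (y : W × (W × ℕ)) =>
      wordValue s e.1 = wordValue s (y.1 ++ y.2.1) ∧ e.2 = y.2.2) h1
    have h3 := REPred.comp h2 (f := fun y : (W × ℕ) × (W × List (W × ℕ)) => (y.2.2, (y.2.1, y.1)))
      (Primrec.to_comp ((Primrec.snd.comp Primrec.snd).pair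
        ((Primrec.fst.comp Primrec.snd).pair Primrec.fst)))
    have h4 := REPred.forall_mem_list (p := fun (q : W × ℕ) (y : W × List (W × ℕ)) =>
      ∃ e ∈ y.2, wordValue s e.1 = wordValue s (y.1 ++ q.1) ∧ e.2 = q.2) h3
    have h5 := REPred.comp h4
      (f := fun y : (PatternCode n × List (W × ℕ)) × W => (y.1.1, (y.2, y.1.2)))
      (Primrec.to_comp ((Primrec.fst.comp Primrec.fst).pair
        (Primrec.snd.pair (Primrec.snd.comp Primrec.fst))))
    have h6 := REPred.exists (p := fun (y : PatternCode n × List (W × ℕ)) (u : W) =>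
      ∀ q ∈ y.1, ∃ e ∈ y.2, wordValue s e.1 = wordValue s (u ++ q.1) ∧ e.2 = q.2) h5
    exact REPred.exists_mem_list (p := fun (p : PatternCode n) (σ : List (W × ℕ)) =>
      ∃ u : W, ∀ q ∈ p, ∃ e ∈ σ, wordValue s e.1 = wordValue s (u ++ q.1) ∧ e.2 = q.2) h6
  have hAB := (REPred.comp hA (f := fun y : List (W × ℕ) × List (PatternCode n) => y.1)
    Computable.fst).or (REPred.comp hB
      (f := fun y : List (W × ℕ) × List (PatternCode n) => (y.2, y.1))
      (Computable.snd.pair Computable.fst))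
  have hall := REPred.forall_mem_list (p := fun (σ : List (W × ℕ)) (F : List (PatternCode n)) =>
    (∃ e ∈ σ, ∃ e' ∈ σ, wordValue s e.1 = wordValue s e'.1 ∧ e.2 ≠ e'.2) ∨
    ∃ p ∈ F, ∃ u, ∀ q ∈ p, ∃ e ∈ σ, wordValue s e.1 = wordValue s (u ++ q.1) ∧ e.2 = q.2) hAB
  have hfin := REPred.comp hall
    (f := fun y : (ℕ × List (PatternCode n)) × List W => (colorings y.1.1 y.2, y.1.2))
    (Primrec.to_comp ((primrec_colorings.comp ((Primrec.fst.comp Primrec.fst).pair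
      Primrec.snd)).pair (Primrec.snd.comp Primrec.fst)))
  exact (REPred.exists (p := fun (i : ℕ × List (PatternCode n)) (V : List W) =>
    ∀ σ ∈ colorings i.1 V,
      (∃ e ∈ σ, ∃ e' ∈ σ, wordValue s e.1 = wordValue s e'.1 ∧ e.2 ≠ e'.2) ∨
      ∃ p ∈ i.2, ∃ u, ∀ q ∈ p, ∃ e ∈ σ, wordValue s e.1 = wordValue s (u ++ q.1) ∧ e.2 = q.2)
    hfin).of_eq fun i => (not_nonempty_sft_iff hs i.1 i.2).symm

end Emptiness

/-! ### Paths in recursively enumerable labelled graphs. -/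

section Paths

variable {α β : Type*}

/-- The word `w` labels a path from `a` to `b` in the labelled graph `R`. -/
def LabelledPath (R : α → β → β → Prop) : List α → β → β → Prop
  | [], a, b => a = b
  | l :: w, a, b => ∃ c, R l a c ∧ LabelledPath R w c b

/-- The endpoint of a list of labelled edges that form a path from `a`. -/
def pathEnd [DecidableEq β] (a : Option β) (T : List (α × β × β)) : Option β :=
  T.foldl (fun acc t => if acc = some t.2.1 then some t.2.2 else none) a

lemma pathEnd_none [DecidableEq β] (T : List (α × β × β)) : pathEnd none T = none := by
  induction T with
  | nil => rfl
  | cons t T ih => simpa [pathEnd] using ih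

/-- Trades the recursion along the word for one existential quantifier over a list of edges, a form
to which the closure properties apply. -/
lemma labelledPath_iff [DecidableEq β] (R : α → β → β → Prop) (w : List α) (a b : β) :
    LabelledPath R w a b ↔ ∃ T : List (α × β × β),
      (∀ t ∈ T, R t.1 t.2.1 t.2.2) ∧ T.map Prod.fst = w ∧ pathEnd (some a) T = some b := by
  induction w generalizing a with
  | nil => simp [LabelledPath, pathEnd]
  | cons l w ih =>
    simp only [LabelledPath, ih]
    constructor
    · rintro ⟨c, hc, T, hT, rfl, hb⟩
      refine ⟨(l, a, c) :: T, ?_, rfl, by simpa [pathEnd] using hb⟩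
      intro t ht
      rcases List.mem_cons.1 ht with rfl | ht
      · exact hc
      · exact hT t ht
    · rintro ⟨T, hT, hw, hb⟩
      rcases T with _ | ⟨⟨l', a', c⟩, T⟩
      · simp at hw
      · simp only [List.map_cons, List.cons.injEq] at hw
        obtain ⟨rfl, rfl⟩ := hw
        by_cases ha : a = a'
        · subst ha
          exact ⟨c, hT (l', a, c) (by simp), T, fun t ht => hT t (by simp [ht]), rfl,
            by simpa [pathEnd] using hb⟩
        · have : pathEnd (some a) ((l', a', c) :: T) = pathEnd none T := by simp [pathEnd, ha]
          rw [this, pathEnd_none] at hb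
          simp at hb

variable [Primcodable α] [Primcodable β]

lemma primrec_pathEnd [DecidableEq β] :
    Primrec fun x : Option β × List (α × β × β) => pathEnd x.1 x.2 := by
  refine Primrec.list_foldl (h := fun (_ : Option β × List (α × β × β))
    (y : Option β × (α × β × β)) => if y.1 = some y.2.2.1 then some y.2.2.2 else none)
    Primrec.snd Primrec.fst ?_
  have : Primrec fun z : (Option β × List (α × β × β)) × (Option β × (α × β × β)) =>
      if z.2.1 = some z.2.2.2.1 then some z.2.2.2.2 else none :=
    Primrec.ite (Primrec.eq.comp (Primrec.fst.comp Primrec.snd) (Primrec.option_some.comp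
      (Primrec.fst.comp (Primrec.snd.comp (Primrec.snd.comp Primrec.snd)))))
      (Primrec.option_some.comp (Primrec.snd.comp (Primrec.snd.comp
        (Primrec.snd.comp Primrec.snd)))) (Primrec.const none)
  exact this

lemma rePred_labelledPath {R : α → β → β → Prop}
    (hR : REPred fun x : α × β × β => R x.1 x.2.1 x.2.2) :
    REPred fun x : List α × β × β => LabelledPath R x.1 x.2.1 x.2.2 := by
  classical
  have h1 := REPred.comp (REPred.forall_mem_list (β := Unit)
    (p := fun (t : α × β × β) _ => R t.1 t.2.1 t.2.2) (hR.comp Computable.fst))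
    (f := fun y : (List α × β × β) × List (α × β × β) => (y.2, ()))
    (Computable.snd.pair (Computable.const ()))
  have h2 : REPred fun y : (List α × β × β) × List (α × β × β) => y.2.map Prod.fst = y.1.1 :=
    rePred_of_primrecPred (Primrec.eq.comp (Primrec.list_map Primrec.snd
      (Primrec.fst.comp Primrec.snd)) (Primrec.fst.comp Primrec.fst))
  have h3 : REPred fun y : (List α × β × β) × List (α × β × β) =>
      pathEnd (some y.1.2.1) y.2 = some y.1.2.2 :=
    rePred_of_primrecPred (Primrec.eq.comp (primrec_pathEnd.comp
      ((Primrec.option_some.comp (Primrec.fst.comp (Primrec.snd.comp Primrec.fst))).pair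
        Primrec.snd)) (Primrec.option_some.comp (Primrec.snd.comp (Primrec.snd.comp Primrec.fst))))
  exact (REPred.exists (p := fun (x : List α × β × β) (T : List (α × β × β)) =>
    (∀ t ∈ T, R t.1 t.2.1 t.2.2) ∧ T.map Prod.fst = x.1 ∧ pathEnd (some x.2.1) T = some x.2.2)
    (h1.and (h2.and h3))).of_eq fun x => (labelledPath_iff R _ _ _).symm

/-- Finitely many recursively enumerable predicates are uniformly recursively enumerable. -/
lemma rePred_uniform_of_finite [Finite α] {p : α → β → Prop} (h : ∀ a, REPred (p a)) :
    REPred fun x : α × β => p x.1 x.2 := by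
  classical
  have := Fintype.ofFinite α
  have key : ∀ l : List α, REPred fun x : α × β => x.1 ∈ l ∧ p x.1 x.2 := by
    intro l
    induction l with
    | nil =>
      exact (rePred_of_primrecPred (PrimrecPred.not (p := fun _ : α × β => True)
        (Primrec.eq.comp (Primrec.const 0) (Primrec.const 0) |>.of_eq (by simp)))).of_eq
          (by simp)
    | cons a l ih =>
      have h1 : REPred fun x : α × β => x.1 = a :=
        rePred_of_primrecPred (Primrec.eq.comp Primrec.fst (Primrec.const a))
      refine ((h1.and ((h a).comp (f := fun x : α × β => x.2) Computable.snd)).or ih).of_eq ?_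
      rintro ⟨b, c⟩
      simp only [List.mem_cons, or_and_right]
      refine or_congr_left (and_congr_right ?_)
      rintro rfl
      rfl
  exact (key Finset.univ.toList).of_eq (by simp)

end Paths

/-! ### Semidecidable disjointness of balls. -/

section Apartness

/-- A semidecidable condition, in terms of the approximations `d` of the distances, that makes
the balls with codes `a` and `b` disjoint. -/
def BallsApart (d : ℕ × ℕ × ℕ → ℕ) (a b : ℕ × ℕ × ℕ) : Prop :=
  ∃ t : ℕ, (a.2.1 * (b.2.2 + 1) + b.2.1 * (a.2.2 + 1)) * 2 ^ t + (a.2.2 + 1) * (b.2.2 + 1) ≤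
    d (a.1, b.1, t) * ((a.2.2 + 1) * (b.2.2 + 1))

lemma primrec_nat_pow : Primrec₂ fun a b : ℕ => a ^ b :=
  Primrec₂.unpaired'.1 Nat.Primrec.pow

lemma rePred_ballsApart {d : ℕ × ℕ × ℕ → ℕ} (hd : Computable d) :
    REPred fun x : (ℕ × ℕ × ℕ) × (ℕ × ℕ × ℕ) => BallsApart d x.1 x.2 := by
  refine REPred.exists ?_
  let D := ((ℕ × ℕ × ℕ) × (ℕ × ℕ × ℕ)) × ℕ
  have pa : Primrec fun y : D => y.1.1.2.1 :=
    Primrec.fst.comp (Primrec.snd.comp (Primrec.fst.comp Primrec.fst))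
  have qa : Primrec fun y : D => y.1.1.2.2 + 1 :=
    Primrec.succ.comp (Primrec.snd.comp (Primrec.snd.comp (Primrec.fst.comp Primrec.fst)))
  have pb : Primrec fun y : D => y.1.2.2.1 :=
    Primrec.fst.comp (Primrec.snd.comp (Primrec.snd.comp Primrec.fst))
  have qb : Primrec fun y : D => y.1.2.2.2 + 1 :=
    Primrec.succ.comp (Primrec.snd.comp (Primrec.snd.comp (Primrec.snd.comp Primrec.fst)))
  have t2 : Primrec fun y : D => 2 ^ y.2 := primrec_nat_pow.comp (Primrec.const 2) Primrec.snd
  have hq := Primrec.nat_mul.comp qa qb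
  have hl := Primrec.nat_add.comp (Primrec.nat_mul.comp (Primrec.nat_add.comp
    (Primrec.nat_mul.comp pa qb) (Primrec.nat_mul.comp pb qa)) t2) hq
  have hdc : Computable fun y : D => d (y.1.1.1, y.1.2.1, y.2) :=
    hd.comp (Primrec.to_comp ((Primrec.fst.comp (Primrec.fst.comp Primrec.fst)).pair
      ((Primrec.fst.comp (Primrec.snd.comp Primrec.fst)).pair Primrec.snd)))
  have hr := Primrec.nat_mul.to_comp.comp hdc hq.to_comp
  exact (rePred_of_primrecPred Primrec.nat_le).comp (hl.to_comp.pair hr)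

variable {M : Type*} [MetricSpace M] {c : ℕ → M} {d : ℕ × ℕ × ℕ → ℕ}

/-- The integer inequality is this one with denominators cleared. The summand `1 / 2 ^ t` absorbs
the error of the approximate distance. -/
lemma ballsApart_iff_exists (a b : ℕ × ℕ × ℕ) :
    BallsApart d a b ↔ ∃ t : ℕ, (a.2.1 : ℝ) / (a.2.2 + 1) + (b.2.1 : ℝ) / (b.2.2 + 1) + 1 / 2 ^ t ≤
      (d (a.1, b.1, t) : ℝ) / 2 ^ t := by
  refine exists_congr fun t => ?_
  have ha : (0 : ℝ) < a.2.2 + 1 := by positivity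
  have hb : (0 : ℝ) < b.2.2 + 1 := by positivity
  have ht : (0 : ℝ) < 2 ^ t := by positivity
  have h : (a.2.1 : ℝ) / (a.2.2 + 1) + (b.2.1 : ℝ) / (b.2.2 + 1) + 1 / 2 ^ t =
      ((a.2.1 * (b.2.2 + 1) + b.2.1 * (a.2.2 + 1)) * 2 ^ t + (a.2.2 + 1) * (b.2.2 + 1)) /
        ((a.2.2 + 1) * (b.2.2 + 1)) / 2 ^ t := by
    field_simp
  rw [h, div_le_div_iff_of_pos_right ht, div_le_iff₀ (by positivity)]
  exact_mod_cast Iff.rfl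

lemma BallsApart.disjoint
    (hd : ∀ i j k : ℕ, |dist (c i) (c j) - (d (i, j, k) : ℝ) / 2 ^ k| ≤ 1 / 2 ^ k)
    {a b : ℕ × ℕ × ℕ} (h : BallsApart d a b) : Disjoint (basicBall c a) (basicBall c b) := by
  obtain ⟨t, ht⟩ := (ballsApart_iff_exists a b).1 h
  refine Metric.ball_disjoint_ball ?_
  have := (abs_le.1 (hd a.1 b.1 t)).1
  linarith

lemma ballsApart_of_lt
    (hd : ∀ i j k : ℕ, |dist (c i) (c j) - (d (i, j, k) : ℝ) / 2 ^ k| ≤ 1 / 2 ^ k)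
    {a b : ℕ × ℕ × ℕ}
    (h : (a.2.1 : ℝ) / (a.2.2 + 1) + (b.2.1 : ℝ) / (b.2.2 + 1) < dist (c a.1) (c b.1)) :
    BallsApart d a b := by
  -- Half the gap, because the error `1 / 2 ^ t` is paid twice: in the approximation and in the
  -- margin that apartness demands.
  obtain ⟨t, ht⟩ := exists_pow_lt_of_lt_one (half_pos (sub_pos.2 h)) (one_half_lt_one (α := ℝ))
  refine (ballsApart_iff_exists a b).2 ⟨t, ?_⟩
  have := (abs_le.1 (hd a.1 b.1 t)).2
  rw [one_div_pow] at ht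
  linarith

end Apartness

lemma exists_list_cover {U ι : Type*} [TopologicalSpace U] [CompactSpace U] {B : ι → Set U}
    (hB : ∀ i, IsOpen (B i)) {P : ι → Prop} (h : ∀ u, ∃ i, P i ∧ u ∈ B i) :
    ∃ l : List ι, (∀ i ∈ l, P i) ∧ ∀ u, ∃ i ∈ l, u ∈ B i := by
  obtain ⟨t, ht⟩ := isCompact_univ.elim_finite_subcover (fun i : {i // P i} => B i)
    (fun i => hB i) (fun u _ => by
      obtain ⟨i, hi, hu⟩ := h u
      exact Set.mem_iUnion.2 ⟨⟨i, hi⟩, hu⟩)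
  refine ⟨t.toList.map Subtype.val, ?_, fun u => ?_⟩
  · intro i hi
    obtain ⟨j, -, rfl⟩ := List.mem_map.1 hi
    exact j.2
  · obtain ⟨i, hi, hu⟩ := Set.mem_iUnion₂.1 (ht (Set.mem_univ u))
    exact ⟨i, List.mem_map.2 ⟨i, by simpa using hi, rfl⟩, hu⟩

/-! ### Finite certificates for equivariant maps into subshifts of finite type. -/

section Semidecision

variable {M : Type*} [MetricSpace M] {c : ℕ → M} {n : ℕ}

/-- A finite certificate for the existence of an equivariant map into a subshift of finite type:
a cover by balls that carry symbols, such that balls with different symbols are disjoint and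
every forbidden pattern is locally avoided. -/
def TilingCertificate (C : List (ℕ × ℕ × ℕ) → Prop) (A : ℕ × ℕ × ℕ → ℕ × ℕ × ℕ → Prop)
    (P : List (Fin n × Bool) → ℕ × ℕ × ℕ → ℕ × ℕ × ℕ → Prop)
    (i : ℕ × List (PatternCode n)) (L : List ((ℕ × ℕ × ℕ) × ℕ)) : Prop :=
  C (L.map Prod.fst) ∧ (∀ e ∈ L, e.2 < i.1) ∧
    (∀ e ∈ L, ∀ e' ∈ L, e.2 = e'.2 ∨ A e.1 e'.1) ∧
    ∀ p ∈ i.2, ∃ l, C l ∧ ∀ a ∈ l, ∃ q ∈ p, ∃ e ∈ L, e.2 ≠ q.2 ∧ P q.1 a e.1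

lemma rePred_exists_tilingCertificate {C : List (ℕ × ℕ × ℕ) → Prop}
    {A : ℕ × ℕ × ℕ → ℕ × ℕ × ℕ → Prop}
    {P : List (Fin n × Bool) → ℕ × ℕ × ℕ → ℕ × ℕ × ℕ → Prop}
    (hC : REPred C) (hA : REPred fun x : (ℕ × ℕ × ℕ) × (ℕ × ℕ × ℕ) => A x.1 x.2)
    (hP : REPred fun x : List (Fin n × Bool) × (ℕ × ℕ × ℕ) × (ℕ × ℕ × ℕ) => P x.1 x.2.1 x.2.2) :
    REPred fun i => ∃ L, TilingCertificate C A P i L := by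
  let B := ℕ × ℕ × ℕ
  let E := B × ℕ
  let I := ℕ × List (PatternCode n)
  let W := List (Fin n × Bool)
  refine REPred.exists ?_
  have h1 : REPred fun x : I × List E => C (x.2.map Prod.fst) :=
    hC.comp (Primrec.to_comp (Primrec.list_map Primrec.snd (Primrec.fst.comp Primrec.snd)))
  have h2 : REPred fun x : I × List E => ∀ e ∈ x.2, e.2 < x.1.1 := by
    have h : REPred fun y : E × ℕ => y.1.2 < y.2 := rePred_of_primrecPred
      (Primrec.nat_lt.comp (Primrec.snd.comp Primrec.fst) Primrec.snd)
    exact (REPred.forall_mem_list (p := fun (e : E) (k : ℕ) => e.2 < k) h).comp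
      (f := fun x : I × List E => (x.2, x.1.1))
      (Primrec.to_comp (Primrec.snd.pair (Primrec.fst.comp Primrec.fst)))
  have h3 : REPred fun x : I × List E => ∀ e ∈ x.2, ∀ e' ∈ x.2, e.2 = e'.2 ∨ A e.1 e'.1 := by
    have h : REPred fun y : E × E => y.2.2 = y.1.2 ∨ A y.2.1 y.1.1 :=
      (rePred_of_primrecPred (Primrec.eq.comp (Primrec.snd.comp Primrec.snd)
        (Primrec.snd.comp Primrec.fst))).or (hA.comp (f := fun y : E × E => (y.2.1, y.1.1))
        (Primrec.to_comp ((Primrec.fst.comp Primrec.snd).pair (Primrec.fst.comp Primrec.fst))))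
    have h' := (REPred.forall_mem_list (p := fun e' e : E => e.2 = e'.2 ∨ A e.1 e'.1) h).comp
      (f := fun y : E × List E => (y.2, y.1)) (Computable.snd.pair Computable.fst)
    exact (REPred.forall_mem_list (p := fun (e : E) (L : List E) =>
      ∀ e' ∈ L, e.2 = e'.2 ∨ A e.1 e'.1) h').comp
      (f := fun x : I × List E => (x.2, x.2)) (Computable.snd.pair Computable.snd)
  have h4 : REPred fun x : I × List E => ∀ p ∈ x.1.2, ∃ l, C l ∧
      ∀ a ∈ l, ∃ q ∈ p, ∃ e ∈ x.2, e.2 ≠ q.2 ∧ P q.1 a e.1 := by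
    have g1 : REPred fun y : E × ((W × ℕ) × B) => y.1.2 ≠ y.2.1.2 ∧ P y.2.1.1 y.2.2 y.1.1 :=
      (rePred_of_primrecPred (Primrec.eq.comp (Primrec.snd.comp Primrec.fst)
        (Primrec.snd.comp (Primrec.fst.comp Primrec.snd))).not).and
      (hP.comp (f := fun y : E × ((W × ℕ) × B) => (y.2.1.1, y.2.2, y.1.1))
        (Primrec.to_comp ((Primrec.fst.comp (Primrec.fst.comp Primrec.snd)).pair
          ((Primrec.snd.comp Primrec.snd).pair (Primrec.fst.comp Primrec.fst)))))
    have g2 := (REPred.exists_mem_list (p := fun (e : E) (y : (W × ℕ) × B) =>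
      e.2 ≠ y.1.2 ∧ P y.1.1 y.2 e.1) g1).comp
      (f := fun y : (W × ℕ) × (List E × B) => (y.2.1, (y.1, y.2.2)))
      (Primrec.to_comp ((Primrec.fst.comp Primrec.snd).pair (Primrec.fst.pair
        (Primrec.snd.comp Primrec.snd))))
    have g3 := (REPred.exists_mem_list (p := fun (q : W × ℕ) (y : List E × B) =>
      ∃ e ∈ y.1, e.2 ≠ q.2 ∧ P q.1 y.2 e.1) g2).comp
      (f := fun y : B × (PatternCode n × List E) => (y.2.1, (y.2.2, y.1)))
      (Primrec.to_comp ((Primrec.fst.comp Primrec.snd).pair ((Primrec.snd.comp Primrec.snd).pair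
        Primrec.fst)))
    have g4 := (REPred.forall_mem_list (p := fun (a : B) (y : PatternCode n × List E) =>
      ∃ q ∈ y.1, ∃ e ∈ y.2, e.2 ≠ q.2 ∧ P q.1 a e.1) g3).comp
      (f := fun y : (PatternCode n × List E) × List B => (y.2, y.1))
      (Computable.snd.pair Computable.fst)
    have g5 := (hC.comp (f := fun y : (PatternCode n × List E) × List B => y.2)
      Computable.snd).and g4
    have g6 := REPred.exists (p := fun (y : PatternCode n × List E) (l : List B) =>
      C l ∧ ∀ a ∈ l, ∃ q ∈ y.1, ∃ e ∈ y.2, e.2 ≠ q.2 ∧ P q.1 a e.1) g5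
    exact (REPred.forall_mem_list (p := fun (p : PatternCode n) (L : List E) =>
      ∃ l, C l ∧ ∀ a ∈ l, ∃ q ∈ p, ∃ e ∈ L, e.2 ≠ q.2 ∧ P q.1 a e.1) g6).comp
      (f := fun x : I × List E => (x.1.2, x.2))
      (Primrec.to_comp ((Primrec.snd.comp Primrec.fst).pair Primrec.snd))
  exact h1.and (h2.and (h3.and h4))

variable {G : Type*} [Group G] {s : Fin n → G} {U : Type*} [MulAction G U] {m : U → M}

/-- Only the relations of the generators and their inverses are available uniformly. Acting by the
inverse of a word applies the inverse of its first letter first, so pulling a ball back along the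
word composes these relations into a path that starts at a ball around `u`. -/
lemma mem_basicBall_iff_labelledPath {R : Fin n × Bool → ℕ × ℕ × ℕ → ℕ × ℕ × ℕ → Prop}
    (hR : ∀ l b u, m ((cond l.2 (s l.1) (s l.1)⁻¹)⁻¹ • u) ∈ basicBall c b ↔
      ∃ a, R l a b ∧ m u ∈ basicBall c a) (w : List (Fin n × Bool)) (b : ℕ × ℕ × ℕ) (u : U) :
    m ((wordValue s w)⁻¹ • u) ∈ basicBall c b ↔
      ∃ a, LabelledPath R w a b ∧ m u ∈ basicBall c a := by
  induction w generalizing u with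
  | nil => simp [LabelledPath]
  | cons l w ih =>
    rw [wordValue_cons, mul_inv_rev, mul_smul, ih]
    simp only [LabelledPath, hR]
    constructor
    · rintro ⟨a, ha, a', ha', hu⟩
      exact ⟨a', ⟨a, ha', ha⟩, hu⟩
    · rintro ⟨a', ⟨a, ha', ha⟩, hu⟩
      exact ⟨a, ha, a', ha', hu⟩

/-- Balls with different symbols are disjoint, so each point of `U` has a well-defined label. The
labels along the orbit of any point form a configuration, and the last clause of the certificate
rules out forbidden patterns at every position. -/
lemma TilingCertificate.nonempty_sft [Nonempty U] {C : List (ℕ × ℕ × ℕ) → Prop}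
    {A : ℕ × ℕ × ℕ → ℕ × ℕ × ℕ → Prop}
    {P : List (Fin n × Bool) → ℕ × ℕ × ℕ → ℕ × ℕ × ℕ → Prop}
    (hC : ∀ l, C l → ∀ u, ∃ b ∈ l, m u ∈ basicBall c b)
    (hA : ∀ a b, A a b → Disjoint (basicBall c a) (basicBall c b))
    (hP : ∀ w a b u, P w a b → m u ∈ basicBall c a →
      m ((wordValue s w)⁻¹ • u) ∈ basicBall c b)
    {i : ℕ × List (PatternCode n)} {L : List ((ℕ × ℕ × ℕ) × ℕ)}
    (h : TilingCertificate C A P i L) : (sft s i.1 i.2).Nonempty := by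
  obtain ⟨h1, h2, h3, h4⟩ := h
  have hcov : ∀ u, ∃ e ∈ L, m u ∈ basicBall c e.1 := by
    intro u
    obtain ⟨b, hb, hu⟩ := hC _ h1 u
    obtain ⟨e, he, rfl⟩ := List.mem_map.1 hb
    exact ⟨e, he, hu⟩
  choose e heL hu using hcov
  have huniq : ∀ u, ∀ e' ∈ L, m u ∈ basicBall c e'.1 → e'.2 = (e u).2 := by
    intro u e' he' hue'
    rcases h3 e' he' (e u) (heL u) with h | h
    · exact h
    · exact absurd (hu u) (Set.disjoint_left.1 (hA _ _ h) hue')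
  obtain ⟨u₀⟩ := ‹Nonempty U›
  refine ⟨fun g => ⟨(e (g⁻¹ • u₀)).2, h2 _ (heL _)⟩, fun p hp g hocc => ?_⟩
  obtain ⟨l, hl, hlp⟩ := h4 p hp
  obtain ⟨a, ha, hua⟩ := hC l hl (g⁻¹ • u₀)
  obtain ⟨q, hq, e', he', hne, hpath⟩ := hlp a ha
  have h5 := hP _ _ _ _ hpath hua
  rw [← mul_smul, ← mul_inv_rev] at h5
  exact hne ((huniq _ e' he' h5).trans (hocc q hq))

/-- The symbol of `f u` at `1` depends locally constantly on `u`, and equivariance recovers all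
other symbols from it. Sufficiently small balls therefore carry constant symbols, and compactness
makes the cover finite. -/
lemma exists_tilingCertificate [TopologicalSpace U] [CompactSpace U] (hc : DenseRange c)
    (hm : Topology.IsEmbedding m)
    {C : List (ℕ × ℕ × ℕ) → Prop} {A : ℕ × ℕ × ℕ → ℕ × ℕ × ℕ → Prop}
    {P : List (Fin n × Bool) → ℕ × ℕ × ℕ → ℕ × ℕ × ℕ → Prop}
    (hC : ∀ l, (∀ u, ∃ b ∈ l, m u ∈ basicBall c b) → C l)
    (hA : ∀ a b : ℕ × ℕ × ℕ, (a.2.1 : ℝ) / (a.2.2 + 1) + (b.2.1 : ℝ) / (b.2.2 + 1) <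
      dist (c a.1) (c b.1) → A a b)
    (hP : ∀ w b u, m ((wordValue s w)⁻¹ • u) ∈ basicBall c b →
      ∃ a, P w a b ∧ m u ∈ basicBall c a)
    {i : ℕ × List (PatternCode n)} {f : U → G → Fin i.1} (hf : Continuous f)
    (hfG : ∀ g u h, f (g • u) h = f u (g⁻¹ * h)) (hfs : ∀ u, f u ∈ sft s i.1 i.2) :
    ∃ L, TilingCertificate C A P i L := by
  have hopen : ∀ b, IsOpen (m ⁻¹' basicBall c b) := fun b =>
    Metric.isOpen_ball.preimage hm.continuous
  have hsymb : Continuous fun u => f u 1 := (continuous_apply 1).comp hf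
  -- Uniform continuity for the metric pulled back along `m`; distinct symbols, viewed as natural
  -- numbers, are at distance at least `1`.
  obtain ⟨δ, hδ, hδf⟩ : ∃ δ > 0, ∀ u v, dist (m u) (m v) < δ → f u 1 = f v 1 := by
    let _ := hm.comapMetricSpace
    have huc := CompactSpace.uniformContinuous_of_continuous
      (continuous_of_discreteTopology.comp hsymb : Continuous fun u => ((f u 1 : ℕ)))
    obtain ⟨δ, hδ, h⟩ := Metric.uniformContinuous_iff.1 huc 1 one_pos
    refine ⟨δ, hδ, fun u v huv => Fin.ext ?_⟩
    by_contra hne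
    exact absurd (h huv) (not_lt.2 (Nat.pairwise_one_le_dist hne))
  -- With radii below `δ / 4`, points in one ball are closer than `δ`, while centres of balls with
  -- different symbols are more than `δ / 2` apart, which exceeds the sum of the radii.
  obtain ⟨q, hq⟩ := exists_nat_one_div_lt (show 0 < δ / 4 by positivity)
  obtain ⟨L, hL, hLcov⟩ := exists_list_cover (fun e : (ℕ × ℕ × ℕ) × ℕ => hopen e.1)
    (P := fun e => e.1.2 = (1, q) ∧ ∃ u, m u ∈ basicBall c e.1 ∧ e.2 = f u 1) (fun u => by
      obtain ⟨j, hj⟩ := hc.exists_dist_lt (m u) (Nat.one_div_pos_of_nat (α := ℝ) (n := q))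
      have hu : m u ∈ basicBall c (j, 1, q) := by simpa [basicBall] using hj
      exact ⟨((j, 1, q), f u 1), ⟨rfl, u, hu, rfl⟩, hu⟩)
  have hrad : ∀ e ∈ L, ∀ u, m u ∈ basicBall c e.1 → dist (m u) (c e.1.1) < δ / 4 := by
    intro e he u hu
    have hu' : dist (m u) (c e.1.1) < (e.1.2.1 : ℝ) / (e.1.2.2 + 1) := hu
    rw [(hL e he).1] at hu'
    simp only [Nat.cast_one] at hu'
    exact hu'.trans hq
  have hval : ∀ e ∈ L, ∀ u, m u ∈ basicBall c e.1 → e.2 = f u 1 := by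
    intro e he u hu
    obtain ⟨v, hv, hev⟩ := (hL e he).2
    rw [hev, hδf v u]
    have h1 := hrad e he u hu
    have h2 := hrad e he v hv
    have h3 := dist_triangle_right (m v) (m u) (c e.1.1)
    linarith
  refine ⟨L, hC _ fun u => ?_, fun e he => ?_, fun e he e' he' => ?_, fun p hp => ?_⟩
  · obtain ⟨e, he, hu⟩ := hLcov u
    exact ⟨e.1, List.mem_map.2 ⟨e, he, rfl⟩, hu⟩
  · obtain ⟨u, -, h⟩ := (hL e he).2
    rw [h]
    exact (f u 1).2
  · refine or_iff_not_imp_left.2 fun hne => hA _ _ ?_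
    obtain ⟨u, hu, heu⟩ := (hL e he).2
    obtain ⟨v, hv, hev⟩ := (hL e' he').2
    have hdist : δ ≤ dist (m u) (m v) := by
      by_contra hlt
      exact hne (by rw [heu, hev, hδf u v (not_le.1 hlt)])
    have h1 := hrad e he u hu
    have h2 := hrad e' he' v hv
    have h3 := dist_triangle4 (m u) (c e.1.1) (c e'.1.1) (m v)
    rw [dist_comm (c e'.1.1) (m v)] at h3
    rw [(hL e he).1, (hL e' he').1]
    simp only [Nat.cast_one]
    linarith
  -- Near each `u` the pattern fails at some entry `r`. A labelled ball around the point moved by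
  -- the inverse of that word witnesses the failure, and a path pulls it back to a ball around `u`.
  · obtain ⟨l, hl, hlcov⟩ := exists_list_cover hopen
      (P := fun a => ∃ q ∈ p, ∃ e ∈ L, e.2 ≠ q.2 ∧ P q.1 a e.1) (fun u => by
        have hocc := hfs u p hp 1
        simp only [PatternCode.OccursAt, one_mul, not_forall] at hocc
        obtain ⟨r, hr, hne⟩ := hocc
        obtain ⟨e, he, hue⟩ := hLcov ((wordValue s r.1)⁻¹ • u)
        have h1 := hval e he _ hue
        rw [hfG, inv_inv, mul_one] at h1
        obtain ⟨a, ha, hua⟩ := hP _ _ _ hue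
        exact ⟨a, ⟨r, hr, e, he, by rw [h1]; exact hne, ha⟩, hua⟩)
    exact ⟨l, hC _ hlcov, hl⟩

/-- For a nonempty effective dynamical system `U` there is a recursively enumerable set of nonempty
subshifts of finite type that contains all those to which `U` maps equivariantly. -/
lemma exists_rePred_of_isEDS (G : Type u) [Group G] {n : ℕ} (s : Fin n → G)
    {U : Type v} [TopologicalSpace U] [MulAction G U] [Nonempty U] (hU : IsEDS G U) :
    ∃ Q : ℕ × List (PatternCode n) → Prop, REPred Q ∧
      (∀ i, Q i → (sft s i.1 i.2).Nonempty) ∧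
      ∀ i, ∀ f : U → G → Fin i.1, Continuous f → (∀ g u h, f (g • u) h = f u (g⁻¹ * h)) →
        (∀ u, f u ∈ sft s i.1 i.2) → Q i := by
  obtain ⟨M, _, c, ⟨hc, d, hd, hdist⟩, Y, ⟨hY, hYC⟩, e, he⟩ := hU
  have : CompactSpace Y := isCompact_iff_compactSpace.1 hY
  have : CompactSpace U := e.symm.compactSpace
  let m : U → M := fun u => (e u : M)
  have hm : Topology.IsEmbedding m := Topology.IsEmbedding.subtypeVal.comp e.isEmbedding
  -- Inverses appear because the symbol of `f u` at `g` is the symbol of `f (g⁻¹ • u)` at `1`.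
  choose R hR hRe using fun l : Fin n × Bool => he (cond l.2 (s l.1) (s l.1)⁻¹)⁻¹
  have hRm : ∀ l b u, m ((cond l.2 (s l.1) (s l.1)⁻¹)⁻¹ • u) ∈ basicBall c b ↔
      ∃ a, R l (a, b) ∧ m u ∈ basicBall c a := by
    intro l b u
    simpa [m] using hRe l b (e u)
  have hpath := mem_basicBall_iff_labelledPath (R := fun l a b => R l (a, b)) hRm
  have hRre : REPred fun x : (Fin n × Bool) × (ℕ × ℕ × ℕ) × (ℕ × ℕ × ℕ) =>
    R x.1 (x.2.1, x.2.2) := rePred_uniform_of_finite hR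
  have hcov : ∀ l : List (ℕ × ℕ × ℕ), (Y ⊆ ⋃ b ∈ l, basicBall c b) ↔
      ∀ u, ∃ b ∈ l, m u ∈ basicBall c b := by
    intro l
    constructor
    · intro h u
      simpa using h (e u).2
    · intro h y hy
      simpa [m] using h (e.symm ⟨y, hy⟩)
  refine ⟨_, rePred_exists_tilingCertificate hYC (rePred_ballsApart hd)
    (rePred_labelledPath (R := fun l a b => R l (a, b)) hRre), fun i => ?_, fun i f hf hfG hfs => ?_⟩
  · rintro ⟨L, hL⟩
    exact hL.nonempty_sft (m := m) (fun l hl => (hcov l).1 hl) (fun a b h => h.disjoint hdist)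
      (fun w a b u h1 h2 => (hpath w b u).2 ⟨a, h1, h2⟩)
  · exact exists_tilingCertificate hc hm (fun l hl => (hcov l).2 hl)
      (fun a b h => ballsApart_of_lt hdist h) (fun w b u h => (hpath w b u).1 h) hf hfG hfs

end Semidecision

/-! ### Computable maps and effectively closed sets in the Cantor space. -/

section Cantor

lemma mem_cyl_iff {w : List Bool} {x : ℕ → Bool} :
    x ∈ cyl w ↔ ∀ j < w.length, w[j]? = some (x j) := by
  constructor
  · intro h j hj
    have h' : initialWord x w.length = w := h
    have h2 : (initialWord x w.length)[j]? = some (x j) := by simp [initialWord, hj]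
    rwa [h'] at h2
  · intro h
    refine List.ext_getElem? fun j => ?_
    by_cases hj : j < w.length
    · rw [h j hj]
      simp [initialWord, hj]
    · rw [List.getElem?_eq_none (not_lt.1 hj), List.getElem?_eq_none]
      simpa [initialWord] using not_lt.1 hj

lemma mem_cyl_initialWord {x z : ℕ → Bool} {N : ℕ} :
    x ∈ cyl (initialWord z N) ↔ ∀ j < N, x j = z j := by
  rw [mem_cyl_iff]
  simp +contextual [initialWord, eq_comm]

/-- The number of terms of the sequence `x ∘ τ` that can be read off from the first `n` terms
of `x`. -/
def readable (τ : ℕ → ℕ) (n : ℕ) : ℕ :=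
  Nat.findGreatest (fun N => ∀ j < N, τ j < n) n

lemma lt_of_lt_readable {τ : ℕ → ℕ} {n j : ℕ} (h : j < readable τ n) : τ j < n :=
  Nat.findGreatest_spec (P := fun N => ∀ j < N, τ j < n) (Nat.zero_le n)
    (fun j hj => absurd hj (Nat.not_lt_zero j)) j h

lemma readable_mono (τ : ℕ → ℕ) : Monotone (readable τ) := fun _ _ h =>
  Nat.findGreatest_mono (fun _ hN j hj => (hN j hj).trans_le h) h

lemma exists_le_readable (τ : ℕ → ℕ) (N : ℕ) : ∃ n, N ≤ readable τ n := by
  refine ⟨N + ∑ j ∈ Finset.range N, (τ j + 1), Nat.le_findGreatest (Nat.le_add_right _ _) ?_⟩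
  intro j hj
  have : τ j + 1 ≤ ∑ j ∈ Finset.range N, (τ j + 1) :=
    Finset.single_le_sum (f := fun j => τ j + 1) (fun _ _ => Nat.zero_le _)
      (Finset.mem_range.2 hj)
  omega

/-- Reindexing of the Cantor space along a primitive recursive map is computable. -/
lemma isComputableCantorMap_of_reindex {Y : Set (ℕ → Bool)} {f : Y → ℕ → Bool} {τ : ℕ → ℕ}
    (hτ : Primrec τ) (h : ∀ y j, f y j = y.1 (τ j)) : IsComputableCantorMap f := by
  -- The default `false` is never used: every readable index satisfies `τ j < w.length`.
  let ψ : List Bool → List Bool := fun w =>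
    (List.range (readable τ w.length)).map fun j => w.getD (τ j) false
  have hread : Primrec (readable τ) := by
    refine Primrec.nat_findGreatest (p := fun n N => ∀ j < N, τ j < n) Primrec.id ?_
    exact (PrimrecRel.forall_lt (R := fun j n => τ j < n) (Primrec.nat_lt.comp
      (hτ.comp Primrec.fst) Primrec.snd)).comp Primrec.snd Primrec.fst
  have hψ : Primrec ψ := Primrec.list_map
    (Primrec.list_range.comp (hread.comp Primrec.list_length))
    ((Primrec.list_getD false).comp Primrec.fst (hτ.comp Primrec.snd))
  have hψw : ∀ (y : Y) n, ψ (initialWord y.1 n) = initialWord (f y) (readable τ n) := by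
    intro y n
    have hlen : (initialWord y.1 n).length = n := by simp [initialWord]
    simp only [ψ, hlen]
    refine List.map_congr_left fun j hj => ?_
    have := lt_of_lt_readable (List.mem_range.1 hj)
    simp [initialWord, List.getD, this, h]
  refine ⟨fun w => Part.some (ψ w), hψ.to_comp, fun y => ⟨fun n => ψ (initialWord y.1 (n + 1)),
    fun n => Part.mem_some _, fun n => ?_, ?_⟩⟩
  · intro x
    simp only [hψw, mem_cyl_initialWord]
    exact fun hx j hj => hx j (hj.trans_le (readable_mono τ (Nat.le_succ _)))
  · ext x
    simp only [hψw, Set.mem_iInter, mem_cyl_initialWord, Set.mem_singleton_iff]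
    constructor
    · intro hx
      funext j
      obtain ⟨n, hn⟩ := exists_le_readable τ (j + 1)
      exact hx n j (hn.trans (readable_mono τ (Nat.le_succ n)))
    · rintro rfl n j -
      rfl

/-- The set of points that violate every constraint of a recursively enumerable family of finite
conjunctions of conditions on coordinates is effectively closed. -/
lemma isEffectivelyClosed_of_constraints {P : List (ℕ × Bool) → Prop} (hP : REPred P) :
    IsEffectivelyClosed {y | ∀ l, P l → ∃ c ∈ l, y c.1 ≠ c.2} := by
  -- A cylinder is removed once its word is long enough to show that all conditions of some
  -- constraint hold.
  refine ⟨fun w => ∃ l, P l ∧ ∀ c ∈ l, w[c.1]? = some c.2, ?_, ?_⟩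
  · have h1 : REPred fun y : (ℕ × Bool) × List Bool => y.2[y.1.1]? = some y.1.2 :=
      rePred_of_primrecPred (Primrec.eq.comp (Primrec.list_getElem?.comp Primrec.snd
        (Primrec.fst.comp Primrec.fst)) (Primrec.option_some.comp (Primrec.snd.comp Primrec.fst)))
    have h2 := (REPred.forall_mem_list (p := fun (c : ℕ × Bool) (w : List Bool) =>
      w[c.1]? = some c.2) h1).comp (f := fun y : List Bool × List (ℕ × Bool) => (y.2, y.1))
      (Computable.snd.pair Computable.fst)
    exact REPred.exists (p := fun (w : List Bool) (l : List (ℕ × Bool)) =>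
      P l ∧ ∀ c ∈ l, w[c.1]? = some c.2) ((hP.comp Computable.snd).and h2)
  · ext y
    simp only [Set.mem_ofPred_eq, Set.mem_compl_iff, Set.mem_iUnion, not_exists]
    constructor
    · rintro h w ⟨l, hl, hw⟩ hy
      obtain ⟨c, hc, hne⟩ := h l hl
      have h1 := hw c hc
      have hlt : c.1 < w.length := (List.getElem?_eq_some_iff.1 h1).1
      rw [mem_cyl_iff.1 hy _ hlt] at h1
      exact hne (Option.some.inj h1)
    · intro h l hl
      by_contra! hne
      obtain ⟨N, hN⟩ : ∃ N, ∀ c ∈ l, c.1 < N := ⟨(l.map fun c => c.1 + 1).sum, fun c hc =>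
        Nat.lt_of_succ_le (List.le_sum_of_mem (List.mem_map.2 ⟨c, hc, rfl⟩))⟩
      refine h (initialWord y N) ⟨l, hl, fun c hc => ?_⟩ (mem_cyl_initialWord.2 fun _ _ => rfl)
      simp [initialWord, hN c hc, hne c hc]

end Cantor

/-! ### Auxiliary enumerability facts. -/

section RecursivelyEnumerable

lemma rePred_exists_and_eq {α β : Type*} [Primcodable α] [Primcodable β] {p : α → Prop}
    (hp : REPred p) {f : α → β} (hf : Computable f) : REPred fun b => ∃ a, p a ∧ b = f a := by
  have h : REPred fun y : β × α => y.1 = f y.2 := by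
    classical
    exact (rePred_of_primrecPred (Primrec.eq (α := β))).comp
      (f := fun y : β × α => (y.1, f y.2)) (Computable.fst.pair (hf.comp Computable.snd))
  exact REPred.exists (p := fun b a => p a ∧ b = f a) ((hp.comp Computable.snd).and h)

/-- A finite table can be hard-coded, however complicated `f` is. This is what lets a noncomputable
sequence of subshifts have effective finite products. -/
lemma primrec_ite_lt {α : Type*} [Primcodable α] (f : ℕ → α) (N : ℕ) (d : α) :
    Primrec fun j => if j < N then f j else d := by
  refine (Primrec.option_getD.comp (Primrec.list_getElem?₁ ((List.range N).map f))
    (Primrec.const d)).of_eq fun j => ?_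
  by_cases h : j < N <;> simp [h]

end RecursivelyEnumerable

/-! ### Finite products of subshifts of finite type are effective. -/

section Layers

variable {G : Type*} {n : ℕ}

variable (T : ℕ → ℕ × List (PatternCode n)) (N : ℕ)

/-- The product of the alphabets of the first `N` subshifts of finite type of a sequence. -/
abbrev LayerAlphabet : Type := ∀ j : Fin N, Fin (T j).1

/-- The number of symbols of the product alphabet. -/
abbrev layerCard : ℕ := Fintype.card (LayerAlphabet T N)

/-- Numbering of the product alphabet. -/
noncomputable def layerEquiv : LayerAlphabet T N ≃ Fin (layerCard T N) := Fintype.equivFin _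

variable {T N}

/-- A layer of a configuration over the product alphabet. -/
noncomputable def layer (j : Fin N) (x : G → Fin (layerCard T N)) : G → Fin (T j).1 :=
  fun g => (layerEquiv T N).symm (x g) j

/-- The configuration over the product alphabet with given layers. -/
noncomputable def ofLayers (z : ∀ j : Fin N, G → Fin (T j).1) : G → Fin (layerCard T N) :=
  fun g => layerEquiv T N fun j => z j g

@[simp] lemma layer_ofLayers (z : ∀ j : Fin N, G → Fin (T j).1) (j : Fin N) :
    layer j (ofLayers z) = z j := by
  funext g; simp [layer, ofLayers]

lemma ext_layer {x x' : G → Fin (layerCard T N)} (h : ∀ j, layer j x = layer j x') : x = x' := by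
  funext g
  exact (layerEquiv T N).symm.injective (funext fun j => congrFun (h j) g)

lemma continuous_layer (j : Fin N) :
    Continuous (layer j : (G → Fin (layerCard T N)) → G → Fin (T j).1) :=
  continuous_pi fun g => (continuous_of_discreteTopology
    (f := fun a => (layerEquiv T N).symm a j)).comp (continuous_apply g)

lemma continuous_ofLayers {X : Type*} [TopologicalSpace X] {z : X → ∀ j : Fin N, G → Fin (T j).1}
    (hz : ∀ j, Continuous fun x => z x j) : Continuous fun x => ofLayers (z x) :=
  continuous_pi fun g => (continuous_of_discreteTopology (f := layerEquiv T N)).comp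
    (continuous_pi fun j => (continuous_apply g).comp (hz j))

variable [Group G] (s : Fin n → G)

lemma isClosed_sft (k : ℕ) (F : List (PatternCode n)) : IsClosed (sft s k F) := by
  have : sft s k F = ⋂ p ∈ {p | p ∈ F}, ⋂ g : G, {x | p.OccursAt s x g}ᶜ := by
    ext x; simp [sft]
  rw [this]
  exact isClosed_biInter fun p _ => isClosed_iInter fun g => (isOpen_occursAt k p g).isClosed_compl

lemma mulShift_mem_sft {k : ℕ} {F : List (PatternCode n)} {x : G → Fin k} (hx : x ∈ sft s k F)
    (g : G) : (fun h => x (g * h)) ∈ sft s k F := fun p hp h hocc =>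
  hx p hp (g * h) fun q hq => by simpa [mul_assoc] using hocc q hq

variable (T N)

/-- The product of the first `N` subshifts of finite type of a sequence. -/
noncomputable def layeredSubshift : MulSubshift (Fin (layerCard T N)) G where
  carrier := {x | ∀ j : Fin N, layer j x ∈ sft s (T j).1 (T j).2}
  isClosed := by
    simp only [Set.ofPred_forall]
    exact isClosed_iInter fun j => (isClosed_sft s _ _).preimage (continuous_layer j)
  mapsTo g _ hx j := mulShift_mem_sft s (hx j) g

/-- The code `(u, j, a)` names the condition that layer `j` has symbol `a` at the position `u`. -/
abbrev CellCode (n : ℕ) : Type := List (Fin n × Bool) × ℕ × ℕ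

/-- The number of a cell code. -/
def cellIndex (v : CellCode n) : ℕ := Encodable.encode v

lemma primrec_cellIndex : Primrec (cellIndex (n := n)) := Primrec.encode

/-- `decode₂` accepts only genuine encodings, so an index names at most one cell and every other
index can be forced to `false`. -/
lemma cellIndex_of_decode {v : CellCode n} {i : ℕ}
    (h : Encodable.decode₂ (CellCode n) i = some v) : cellIndex v = i :=
  Encodable.decode₂_eq_some.1 h

variable {T N}

/-- The condition named by a cell code. -/
def CellHolds (x : G → Fin (layerCard T N)) (v : CellCode n) : Prop :=
  ∃ h : v.2.1 < N, (layer ⟨v.2.1, h⟩ x (wordValue s v.1) : ℕ) = v.2.2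

open Classical in
/-- The point of the Cantor space that lists the conditions that hold for `x`. -/
noncomputable def cantorCode (x : G → Fin (layerCard T N)) (i : ℕ) : Bool :=
  (Encodable.decode₂ (CellCode n) i).elim false fun v => decide (CellHolds s x v)

variable {s}

lemma cantorCode_cellIndex {x : G → Fin (layerCard T N)} {v : CellCode n} :
    cantorCode s x (cellIndex v) = true ↔ CellHolds s x v := by
  simp [cantorCode, cellIndex]

lemma cantorCode_of_decode {x : G → Fin (layerCard T N)} {i : ℕ}
    (h : Encodable.decode₂ (CellCode n) i = none) : cantorCode s x i = false := by
  simp [cantorCode, h]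

lemma continuous_cantorCode :
    Continuous (cantorCode s : (G → Fin (layerCard T N)) → ℕ → Bool) := by
  refine continuous_pi fun i => ?_
  cases h : Encodable.decode₂ (CellCode n) i with
  | none => simpa [cantorCode, h] using continuous_const
  | some v =>
    classical
    have := (continuous_of_discreteTopology (f := fun b : Fin (layerCard T N) =>
      decide (∃ h : v.2.1 < N, ((layerEquiv T N).symm b ⟨v.2.1, h⟩ : ℕ) = v.2.2))).comp
      (continuous_apply (A := fun _ : G => Fin (layerCard T N)) (wordValue s v.1))
    refine this.congr fun x => ?_
    simp only [Function.comp, cantorCode, h, Option.elim]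
    exact decide_eq_decide.2 Iff.rfl

lemma cantorCode_injective (hs : Subgroup.closure (Set.range s) = ⊤) :
    Function.Injective (cantorCode s : (G → Fin (layerCard T N)) → ℕ → Bool) := by
  intro x x' hxx
  refine ext_layer fun j => funext fun g => Fin.ext ?_
  obtain ⟨u, rfl⟩ := wordValue_surjective s hs g
  have h : CellHolds s x (u, j, layer j x (wordValue s u)) := ⟨j.2, rfl⟩
  rw [← cantorCode_cellIndex, hxx, cantorCode_cellIndex] at h
  exact h.2.symm

variable (s T N)

/-- The finite conjunctions of conditions on coordinates that a point of the Cantor space must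
violate in order to describe a point of the product of the first `N` subshifts. -/
def LayerConstraint (l : List (ℕ × Bool)) : Prop :=
  (∃ i : ℕ, Encodable.decode₂ (CellCode n) i = none ∧ l = [(i, true)]) ∨
  (∃ z : (List (Fin n × Bool) × List (Fin n × Bool)) × ℕ × ℕ × ℕ,
    (wordValue s z.1.1 = wordValue s z.1.2 ∧ z.2.2.1 ≠ z.2.2.2) ∧
      l = [(cellIndex (z.1.1, z.2.1, z.2.2.1), true),
        (cellIndex (z.1.2, z.2.1, z.2.2.2), true)]) ∨
  (∃ v : CellCode n, (if v.2.1 < N then (T v.2.1).1 else 0) ≤ v.2.2 ∧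
    l = [(cellIndex v, true)]) ∨
  (∃ z : List (Fin n × Bool) × ℕ, z.2 < N ∧
    l = (List.range (if z.2 < N then (T z.2).1 else 0)).map
      fun a => (cellIndex (z.1, z.2, a), false)) ∨
  (∃ z : (List (Fin n × Bool) × ℕ) × PatternCode n,
    z.2 ∈ (if z.1.2 < N then (T z.1.2).2 else []) ∧
      l = z.2.map fun q => (cellIndex (z.1.1 ++ q.1, z.1.2, q.2), true))

lemma rePred_layerConstraint (hwp : DecidableWordProblem s) :
    REPred (LayerConstraint T N s) := by
  have hK := primrec_ite_lt (fun j => (T j).1) N 0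
  have hF := primrec_ite_lt (fun j => (T j).2) N []
  refine .or ?_ (.or ?_ (.or ?_ (.or ?_ ?_)))
  · refine rePred_exists_and_eq (p := fun i => Encodable.decode₂ (CellCode n) i = none)
      (f := fun i => [(i, true)]) (rePred_of_primrecPred
      (Primrec.eq.comp Primrec.decode₂ (Primrec.const none))) (Primrec.to_comp ?_)
    exact Primrec.list_cons.comp (Primrec.id.pair (Primrec.const true)) (Primrec.const [])
  · refine rePred_exists_and_eq (REPred.and ((rePred_wordValue_eq hwp).comp
      Computable.fst) (rePred_of_primrecPred (Primrec.eq.comp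
        (Primrec.fst.comp (Primrec.snd.comp Primrec.snd))
        (Primrec.snd.comp (Primrec.snd.comp Primrec.snd))).not)) (Primrec.to_comp ?_)
    refine Primrec.list_cons.comp ((primrec_cellIndex.comp ((Primrec.fst.comp Primrec.fst).pair
      ((Primrec.fst.comp Primrec.snd).pair
        (Primrec.fst.comp (Primrec.snd.comp Primrec.snd))))).pair (Primrec.const true)) ?_
    exact Primrec.list_cons.comp ((primrec_cellIndex.comp ((Primrec.snd.comp Primrec.fst).pair
      ((Primrec.fst.comp Primrec.snd).pair
        (Primrec.snd.comp (Primrec.snd.comp Primrec.snd))))).pair (Primrec.const true))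
      (Primrec.const [])
  · refine rePred_exists_and_eq (rePred_of_primrecPred (Primrec.nat_le.comp
      (hK.comp (Primrec.fst.comp Primrec.snd)) (Primrec.snd.comp Primrec.snd)))
      (Primrec.to_comp ?_)
    exact Primrec.list_cons.comp (primrec_cellIndex.pair (Primrec.const true)) (Primrec.const [])
  · refine rePred_exists_and_eq (rePred_of_primrecPred (Primrec.nat_lt.comp
      Primrec.snd (Primrec.const N))) (Primrec.to_comp ?_)
    refine Primrec.list_map (Primrec.list_range.comp (hK.comp Primrec.snd)) ?_
    exact (primrec_cellIndex.comp ((Primrec.fst.comp Primrec.fst).pair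
      ((Primrec.snd.comp Primrec.fst).pair Primrec.snd))).pair (Primrec.const false)
  · refine rePred_exists_and_eq (rePred_of_primrecPred (primrecRel_mem_list.comp
      Primrec.snd (hF.comp (Primrec.snd.comp Primrec.fst)))) (Primrec.to_comp ?_)
    refine Primrec.list_map Primrec.snd ?_
    exact (primrec_cellIndex.comp ((Primrec.list_append.comp
      (Primrec.fst.comp (Primrec.fst.comp Primrec.fst)) (Primrec.fst.comp Primrec.snd)).pair
      ((Primrec.snd.comp (Primrec.fst.comp Primrec.fst)).pair
        (Primrec.snd.comp Primrec.snd)))).pair (Primrec.const true)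

variable {s T N}

lemma cantorCode_violates_layerConstraint {x : G → Fin (layerCard T N)}
    (hx : x ∈ (layeredSubshift T N s).carrier) {l : List (ℕ × Bool)}
    (hl : LayerConstraint T N s l) : ∃ c ∈ l, cantorCode s x c.1 ≠ c.2 := by
  by_contra hl'
  have hne : ∀ c ∈ l, cantorCode s x c.1 = c.2 := fun c hc =>
    by_contra fun h => hl' ⟨c, hc, h⟩
  clear hl'
  have H : ∀ v : CellCode n, (cellIndex v, true) ∈ l → CellHolds s x v := by
    intro v hv
    have h : cantorCode s x (cellIndex v) = true := hne (cellIndex v, true) hv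
    rwa [cantorCode_cellIndex] at h
  rcases hl with ⟨i, hi, rfl⟩ | ⟨⟨⟨u, u'⟩, j, a, a'⟩, ⟨hu, ha⟩, rfl⟩ | ⟨⟨u, j, a⟩, ha, rfl⟩ |
    ⟨⟨u, j⟩, hj, rfl⟩ | ⟨⟨⟨u, j⟩, p⟩, hp, rfl⟩
  · have := hne _ (List.mem_singleton_self _)
    rw [cantorCode_of_decode hi] at this
    exact Bool.false_ne_true this
  · obtain ⟨h, h1⟩ := H (u, j, a) List.mem_cons_self
    obtain ⟨h', h2⟩ := H (u', j, a') (List.mem_cons_of_mem _ (List.mem_singleton_self _))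
    simp only at h1 h2 hu ha
    rw [hu] at h1
    exact ha (h1.symm.trans h2)
  · obtain ⟨h, h1⟩ := H (u, j, a) (List.mem_singleton_self _)
    simp only at h h1 ha
    rw [if_pos h, ← h1] at ha
    exact absurd (Fin.is_lt _) (not_lt.2 ha)
  · simp only at hj
    let a := layer ⟨j, hj⟩ x (wordValue s u)
    have h1 := hne (cellIndex (u, j, (a : ℕ)), false)
      (List.mem_map.2 ⟨a, by simp [hj, a.2], rfl⟩)
    have h2 : cantorCode s x (cellIndex (u, j, (a : ℕ))) = true :=
      cantorCode_cellIndex.2 ⟨hj, rfl⟩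
    exact Bool.false_ne_true (h1.symm.trans h2)
  · simp only at hp
    split_ifs at hp with hj
    · refine hx ⟨j, hj⟩ p hp (wordValue s u) fun q hq => ?_
      obtain ⟨_, h⟩ := H (u ++ q.1, j, q.2) (List.mem_map.2 ⟨q, hq, rfl⟩)
      rw [← wordValue_append]
      exact h
    · simp at hp

/-- Each clause of `LayerConstraint` supplies one ingredient of decoding: silence at meaningless
indices, uniqueness of the symbol whichever word names the position, silence outside the layers and
alphabets, existence of a symbol, and avoidance of the forbidden patterns. -/
lemma exists_cantorCode_eq (hs : Subgroup.closure (Set.range s) = ⊤) {y : ℕ → Bool}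
    (hy : ∀ l, LayerConstraint T N s l → ∃ c ∈ l, y c.1 ≠ c.2) :
    ∃ x ∈ (layeredSubshift T N s).carrier, cantorCode s x = y := by
  have h1 : ∀ i, Encodable.decode₂ (CellCode n) i = none → y i = false := fun i hi => by
    simpa using hy _ (.inl ⟨i, hi, rfl⟩)
  have h2 : ∀ u u' j a a', wordValue s u = wordValue s u' →
      y (cellIndex (u, j, a)) = true →
      y (cellIndex (u', j, a')) = true → a = a' := by
    intro u u' j a a' hu ha ha'
    by_contra hne
    have := hy _ (.inr (.inl ⟨((u, u'), j, a, a'), ⟨hu, hne⟩, rfl⟩))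
    simp [ha, ha'] at this
  have h3 : ∀ (u : List (Fin n × Bool)) j a, N ≤ j → y (cellIndex (u, j, a)) = false := by
    intro u j a hj
    have := hy _ (.inr (.inr (.inl ⟨(u, j, a), by simp [not_lt.2 hj], rfl⟩)))
    simpa using this
  have h4 : ∀ (u : List (Fin n × Bool)) (j : Fin N), ∃ a : Fin (T j).1,
      y (cellIndex (u, (j : ℕ), (a : ℕ))) = true := by
    intro u j
    obtain ⟨c, hc, hne⟩ := hy _ (.inr (.inr (.inr (.inl ⟨(u, j), j.2, rfl⟩))))
    obtain ⟨a, ha, rfl⟩ := List.mem_map.1 hc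
    have ha' : a < (T j).1 := by simpa using ha
    exact ⟨⟨a, ha'⟩, by simpa using hne⟩
  have h5 : ∀ (u : List (Fin n × Bool)) (j : Fin N), ∀ p ∈ (T j).2, ∃ q ∈ p,
      y (cellIndex (u ++ q.1, (j : ℕ), q.2)) = false := by
    intro u j p hp
    obtain ⟨c, hc, hne⟩ := hy _ (.inr (.inr (.inr (.inr ⟨((u, j), p), by simpa using hp, rfl⟩))))
    obtain ⟨q, hq, rfl⟩ := List.mem_map.1 hc
    exact ⟨q, hq, by simpa using hne⟩
  choose a ha using h4
  -- One word per group element; by `h2` the symbol does not depend on this choice.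
  choose w hw using wordValue_surjective s hs
  let x : G → Fin (layerCard T N) := ofLayers fun j g => a (w g) j
  have hx : ∀ u (j : Fin N), layer j x (wordValue s u) = a u j := by
    intro u j
    simp only [x, layer_ofLayers]
    exact Fin.ext (h2 _ _ _ _ _ (hw _) (ha _ j) (ha u j))
  refine ⟨x, fun j p hp g hocc => ?_, ?_⟩
  · obtain ⟨q, hq, hyq⟩ := h5 (w g) j p hp
    have h := hocc q hq
    rw [← hw g, ← wordValue_append, hx] at h
    have h' := ha (w g ++ q.1) j
    rw [h, hyq] at h'
    exact Bool.false_ne_true h'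
  · funext i
    cases hi : Encodable.decode₂ (CellCode n) i with
    | none => rw [cantorCode_of_decode hi, h1 i hi]
    | some v =>
      obtain ⟨u, j, b⟩ := v
      rw [← cellIndex_of_decode hi, Bool.eq_iff_iff, cantorCode_cellIndex]
      constructor
      · rintro ⟨hj, hb⟩
        simp only at hj hb
        rw [hx] at hb
        rw [← hb]
        exact ha u ⟨j, hj⟩
      · intro hyi
        have hj : j < N := by
          by_contra hj
          rw [h3 u j b (not_lt.1 hj)] at hyi
          exact Bool.false_ne_true hyi
        refine ⟨hj, ?_⟩
        simp only
        rw [hx]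
        exact h2 u u j _ _ rfl (ha u ⟨j, hj⟩) hyi

variable (s T N)

lemma isEffectiveSubshift_layeredSubshift (hs : Subgroup.closure (Set.range s) = ⊤)
    (hwp : DecidableWordProblem s) : IsEffectiveSubshift (layeredSubshift T N s) := by
  let Y := {y : ℕ → Bool | ∀ l, LayerConstraint T N s l → ∃ c ∈ l, y c.1 ≠ c.2}
  let F : (layeredSubshift T N s).carrier → Y := fun x =>
    ⟨cantorCode s x.1, fun _ hl => cantorCode_violates_layerConstraint x.2 hl⟩
  have hF : Function.Bijective F := by
    constructor
    · intro x x' h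
      exact Subtype.ext (cantorCode_injective hs (congrArg Subtype.val h))
    · intro y
      obtain ⟨x, hx, hxy⟩ := exists_cantorCode_eq hs y.2
      exact ⟨⟨x, hx⟩, Subtype.ext hxy⟩
  have hcont : Continuous (Equiv.ofBijective F hF) :=
    (continuous_cantorCode.comp continuous_subtype_val).subtype_mk _
  have : CompactSpace (layeredSubshift T N s).carrier :=
    isCompact_iff_compactSpace.1 (layeredSubshift T N s).isClosed.isCompact
  let e := hcont.homeoOfEquivCompactToT2
  refine ⟨Y, isEffectivelyClosed_of_constraints (rePred_layerConstraint T N s hwp), e, fun g => ?_⟩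
  obtain ⟨w, hw⟩ := wordValue_surjective s hs g⁻¹
  -- Acting by `g` prepends to each position a word for `g⁻¹`. Indices that name no cell stay fixed,
  -- where both codes are `false`.
  let τ : ℕ → ℕ := fun i => Option.casesOn (Encodable.decode₂ (CellCode n) i) i
    fun v => cellIndex (w ++ v.1, v.2)
  have hτ : Primrec τ := by
    refine Primrec.option_casesOn Primrec.decode₂ Primrec.id ?_
    exact primrec_cellIndex.comp ((Primrec.list_append.comp (Primrec.const w)
      (Primrec.fst.comp Primrec.snd)).pair (Primrec.snd.comp Primrec.snd))
  refine isComputableCantorMap_of_reindex hτ fun y i => ?_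
  obtain ⟨x, rfl⟩ := e.surjective y
  rw [e.symm_apply_apply]
  change cantorCode s (g • x).1 i = cantorCode s x.1 (τ i)
  cases hi : Encodable.decode₂ (CellCode n) i with
  | none => simp [τ, hi, cantorCode_of_decode hi]
  | some v =>
    have hτi : τ i = cellIndex (w ++ v.1, v.2) := by simp [τ, hi]
    rw [hτi, ← cellIndex_of_decode hi, Bool.eq_iff_iff, cantorCode_cellIndex,
      cantorCode_cellIndex]
    have hl : ∀ j : Fin N, layer j (g • x).1 (wordValue s v.1) =
        layer j x.1 (wordValue s (w ++ v.1)) := by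
      intro j
      rw [wordValue_append, hw]
      rfl
    simp only [CellHolds, hl]

end Layers

/-! ### The inverse limit of the finite products. -/

section InverseLimits

/-- The pointwise action on an inverse limit along equivariant maps. -/
abbrev inverseLimitAction {G : Type*} [Group G] {Y : ℕ → Type*} [∀ n, MulAction G (Y n)]
    {π : ∀ n, Y (n + 1) → Y n} (h : ∀ n (g : G) y, π n (g • y) = g • π n y) :
    MulAction G (InverseLimit Y π) where
  smul g y := ⟨fun n => g • y.1 n, fun n => (congrArg (g • ·) (y.2 n)).trans (h n g _).symm⟩
  one_smul y := Subtype.ext (funext fun n => one_smul G (y.1 n))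
  mul_smul g g' y := Subtype.ext (funext fun n => mul_smul g g' (y.1 n))

variable {G : Type*} [Group G] {n : ℕ} (s : Fin n → G) (T : ℕ → ℕ × List (PatternCode n))

/-- The map that forgets the last layer. -/
noncomputable def forgetLayer (N : ℕ) (x : (layeredSubshift T (N + 1) s).carrier) :
    (layeredSubshift T N s).carrier :=
  ⟨ofLayers fun j => layer j.castSucc x.1, fun j => by
    rw [layer_ofLayers]
    exact x.2 j.castSucc⟩

lemma layer_forgetLayer {N : ℕ} (x : (layeredSubshift T (N + 1) s).carrier) (j : Fin N) :
    layer j (forgetLayer s T N x).1 = layer j.castSucc x.1 :=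
  layer_ofLayers _ _

variable {s T}

lemma isFactorMap_forgetLayer (hT : ∀ m, (sft s (T m).1 (T m).2).Nonempty) (N : ℕ) :
    IsFactorMap G (forgetLayer s T N) where
  continuous := (continuous_ofLayers fun j =>
    (continuous_layer j.castSucc).comp continuous_subtype_val).subtype_mk _
  map_smul _ _ := rfl
  surjective y := by
    -- Layers are independent, so any point of the new subshift serves as the missing layer.
    obtain ⟨z, hz⟩ := hT N
    let x : G → Fin (layerCard T (N + 1)) := ofLayers
      (Fin.snoc (α := fun j : Fin (N + 1) => G → Fin (T j).1) (fun j => layer j y.1) z)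
    refine ⟨⟨x, fun j => ?_⟩, Subtype.ext (ext_layer fun j => ?_)⟩
    · induction j using Fin.lastCases with
      | last => simpa [x] using hz
      | cast j => simpa [x] using y.2 j
    · rw [layer_forgetLayer]
      simp [x]

/-- Ensures that a system factoring onto the limit has a point, whose orbit certificates can then be
read along. -/
lemma nonempty_inverseLimit_forgetLayer (hT : ∀ m, (sft s (T m).1 (T m).2).Nonempty) :
    Nonempty (InverseLimit (fun N => (layeredSubshift T N s).carrier) (forgetLayer s T)) := by
  choose z hz using hT
  exact ⟨⟨fun N => ⟨ofLayers fun j => z j, fun j => by rw [layer_ofLayers]; exact hz j⟩,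
    fun N => Subtype.ext (ext_layer fun j => by rw [layer_forgetLayer]; simp)⟩⟩

end InverseLimits

/-- There is an enumeration of nonempty subshifts of finite type in which all of them occur. -/
lemma exists_enumeration_nonempty_sft {G : Type*} [Group G] {n : ℕ} (s : Fin n → G) :
    ∃ T : ℕ → ℕ × List (PatternCode n), (∀ m, (sft s (T m).1 (T m).2).Nonempty) ∧
      ∀ i, (sft s i.1 i.2).Nonempty → ∃ m, T m = i := by
  have h1 : (sft s 1 []).Nonempty := ⟨fun _ => 0, fun p hp => by simp at hp⟩
  have : Nonempty {i : ℕ × List (PatternCode n) // (sft s i.1 i.2).Nonempty} := ⟨⟨(1, []), h1⟩⟩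
  -- The surjection comes from countability alone, with no effectiveness.
  obtain ⟨f, hf⟩ := exists_surjective_nat
    {i : ℕ × List (PatternCode n) // (sft s i.1 i.2).Nonempty}
  refine ⟨fun m => (f m).1, fun m => (f m).2, fun i hi => ?_⟩
  obtain ⟨m, hm⟩ := hf ⟨i, hi⟩
  exact ⟨m, congrArg Subtype.val hm⟩

end EffDyn

theorem theoremA (G : Type u) [Group G] (n : ℕ) (s : Fin n → G)
    (hs : Subgroup.closure (Set.range s) = ⊤)
    (hwp : EffDyn.DecidableWordProblem s)
    (hdp : ¬ EffDyn.DecidableDominoProblem s) :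
    ∃ (X : Type u) (_ : TopologicalSpace X) (_ : MulAction G X),
      EffDyn.IsWEDS G X ∧ EffDyn.IsInverseLimitOfEffectiveSubshifts G X ∧
      ∀ (U : Type v) [TopologicalSpace U] [MulAction G U],
        EffDyn.IsEDS G U → ¬ EffDyn.IsTopologicalFactor G X U := by
  open EffDyn in
  obtain ⟨T, hT, hTs⟩ := exists_enumeration_nonempty_sft s
  let Y : ℕ → Type u := fun N => (layeredSubshift T N s).carrier
  have hπ := isFactorMap_forgetLayer hT
  let act : MulAction G (InverseLimit Y (forgetLayer s T)) :=
    inverseLimitAction fun N => (hπ N).map_smul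
  have hlim : IsInverseLimitOf G (InverseLimit Y (forgetLayer s T)) Y :=
    ⟨forgetLayer s T, hπ, Homeomorph.refl _, fun _ _ _ => rfl⟩
  have heff := fun N => isEffectiveSubshift_layeredSubshift T N s hs hwp
  refine ⟨InverseLimit Y (forgetLayer s T), inferInstance, act,
    ⟨Y, inferInstance, inferInstance, heff, hlim⟩,
    ⟨fun N => layerCard T N, fun N => layeredSubshift T N s, heff, hlim⟩, ?_⟩
  rintro U _ _ hU ⟨f, hf⟩
  have : Nonempty U := by
    obtain ⟨x⟩ := nonempty_inverseLimit_forgetLayer hT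
    exact ⟨(hf.surjective x).choose⟩
  obtain ⟨Q, hQ, hQs, hsQ⟩ := exists_rePred_of_isEDS G s hU
  -- Post's theorem: `Q` turns out to be exactly nonemptiness, and both it and its complement are
  -- recursively enumerable.
  refine hdp (ComputablePred.computable_iff_re_compl_re'.2 ⟨hQ.of_eq fun i => ⟨hQs i, ?_⟩,
    rePred_not_nonempty_sft hs hwp⟩)
  intro hi
  obtain ⟨m, rfl⟩ := hTs i hi
  -- Stage `m + 1` is the first whose product includes `T m`, as its last layer.
  refine hsQ (T m) (fun u => layer (Fin.last m) ((f u).1 (m + 1)).1) ?_ ?_ ?_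
  · exact (continuous_layer (Fin.last m)).comp (continuous_subtype_val.comp
      ((continuous_apply (m + 1)).comp (continuous_subtype_val.comp hf.continuous)))
  · intro g u h
    rw [hf.map_smul]
    rfl
  · exact fun u => ((f u).1 (m + 1)).2 (Fin.last m)
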